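/- Let $J_z=\operatorname{diag}(1,0,-1)$, let $\mathcal R$ be a random rotation distributed according to the normalized Haar measure of $\mathrm{SO}(3)$, let $C=J_z+\mathcal R J_z\mathcal R^T$, and let $P,Q$ be the random variables defined by $\det(tI-C)=t^3+Pt+Q$. In Euler angles $\mathcal R=\mathcal R_z(\phi)\mathcal R_y(\theta)\mathcal R_z(\psi)$, with $x=\cos\phi$, $y=\cos\psi$, $c=\cos\theta$, one has $P-p=P_p(c)$ and $Q-q=Q_q(c)$ with $$P_p(c)=-c^2(1+x^2)(1+y^2)+2c\,xy\sin\phi\sin\psi-(x^2y^2-2x^2-2y^2+3)-p,$$ $$Q_q(c)=2c^2(1-x^2y^2)+4c\,xy\sin\phi\sin\psi-2(1-x^2)(1-y^2)-q.$$ If $-2\le q\le 0$ and $Q_q$ is not the zero polynomial, all real roots of $Q_q$ lie in $[-1,1]$. With $u=x^2$ and $z=y^2$, the resultant of $P_p$ and $Q_q$ in $c$ (both taken with formal degree $2$) is $$\begin{aligned}R(u,z;p,q)={}&4p^2(1-uz)^2+4pq(1+u)(1+z)(1-uz)\\&-8p\big(-4+2(u+z)+(u+z)^2-2uz(u+z)+uz(u-z)^2\big)\\&+q^2\big((1+uz)^2+(u+z)^2+2uz(u+z)+2(u+z)\big)\\&+4q\big(4-u^3+2u^2z^2-z^3+2(u+z)-uz(u+z)-3(u+z)^2+3uz(u^2+z^2)\big)\\&+4(u^4-8u^3z-2u^2z^2-8uz^3+z^4)+16(u+z)^3-16(u-z)^2+64(1-u-z),\end{aligned}$$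 which is symmetric in $u,z$ and, for all real $z,p,q$, of degree $4$ in $u$. The law of $(P,Q)$ has a density $\rho(p,q)$ with respect to Lebesgue measure $dp\,dq$, and for almost every $(p,q)$ with $-2\le q\le 0$ $$\rho(p,q)=\frac{2}{\pi^2}\int_0^1 dz\sum_{\substack{u\in[0,1]\\ R(u,z;p,q)=0}}\frac{2+u+z}{|\partial_uR(u,z;p,q)|},$$ where the sum is over distinct roots, a term with vanishing denominator is $+\infty$, and the right-hand side is read in $[0,\infty]$. Moreover $\rho(p,-q)=\rho(p,q)$ almost everywhere; consequently, for almost every $(p,q)$ with $0<q\le 2$, $\rho(p,q)$ is given by the same formula with $q$ replaced by $-q$; and $\rho(p,q)=0$ for almost every $(p,q)$ with $|q|>2$. -/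

import Mathlib

open MeasureTheory ProbabilityTheory Polynomial
open scoped ENNReal Matrix

namespace HornSymm

/-- The group `SO(3)` of real `3 × 3` rotation matrices. -/
abbrev SO3 : Type := Matrix.specialOrthogonalGroup (Fin 3) ℝ

instance : IsTopologicalGroup SO3 where
  continuous_inv := by
    refine Continuous.subtype_mk (f := fun g : SO3 => star (g : Matrix (Fin 3) (Fin 3) ℝ)) ?_ _
    exact continuous_subtype_val.star

instance : CompactSpace SO3 := by
  have hcl : IsClosed {M : Matrix (Fin 3) (Fin 3) ℝ | M * star M = 1 ∧ M.det = 1} :=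
    (isClosed_eq (by fun_prop) (by fun_prop)).inter (isClosed_eq (by fun_prop) (by fun_prop))
  have hK : IsCompact {M : Fin 3 → Fin 3 → ℝ | ∀ i j, M i j ∈ Set.Icc (-1 : ℝ) 1} := by
    have h : IsCompact (Set.pi Set.univ fun _ : Fin 3 =>
        Set.pi Set.univ fun _ : Fin 3 => Set.Icc (-1 : ℝ) 1) :=
      isCompact_univ_pi fun _ => isCompact_univ_pi fun _ => isCompact_Icc
    simpa [Set.pi] using h
  suffices hc : IsCompact (Matrix.specialOrthogonalGroup (Fin 3) ℝ :
      Set (Matrix (Fin 3) (Fin 3) ℝ)) from isCompact_iff_compactSpace.mp hc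
  have hset : (Matrix.specialOrthogonalGroup (Fin 3) ℝ : Set (Matrix (Fin 3) (Fin 3) ℝ)) =
      {M | M * star M = 1 ∧ M.det = 1} := by
    ext M
    rw [SetLike.mem_coe, Matrix.mem_specialOrthogonalGroup_iff, Matrix.mem_orthogonalGroup_iff]
    rfl
  rw [hset]
  refine IsCompact.of_isClosed_subset hK hcl ?_
  rintro M ⟨h, -⟩ i j
  have h1 : ∑ k, M i k * M i k = 1 := by
    have := congrFun (congrFun h i) i
    simpa [Matrix.mul_apply] using this
  have h2 : M i j * M i j ≤ ∑ k, M i k * M i k :=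
    Finset.single_le_sum (f := fun k => M i k * M i k)
      (fun k _ => mul_self_nonneg _) (Finset.mem_univ j)
  constructor <;> nlinarith

instance : MeasurableSpace SO3 := borel SO3

instance : BorelSpace SO3 := ⟨rfl⟩

/-- The normalized Haar measure of `SO(3)` (total mass one). -/
noncomputable def haarSO3 : Measure SO3 :=
  Measure.haarMeasure (⊤ : TopologicalSpace.PositiveCompacts SO3)

/-- `J_z = diag(1, 0, -1)`. -/
def Jz : Matrix (Fin 3) (Fin 3) ℝ := Matrix.diagonal ![1, 0, -1]

/-- `C = J_z + M J_z Mᵀ`. -/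
def sumC (M : Matrix (Fin 3) (Fin 3) ℝ) : Matrix (Fin 3) (Fin 3) ℝ := Jz + M * Jz * Mᵀ

/-- The random vector `(P, Q)` of coefficients of `det (z I - C) = z³ + P z + Q`. -/
noncomputable def PQ (g : SO3) : ℝ × ℝ :=
  ((sumC g).charpoly.coeff 1, (sumC g).charpoly.coeff 0)

/-- The probability density function of `(P, Q)` with respect to Lebesgue measure `dp dq`. -/
noncomputable def rho : ℝ × ℝ → ℝ≥0∞ := pdf PQ haarSO3 volume

/-- The rotation by `t` about the `z` axis. -/
noncomputable def rotZ (t : ℝ) : Matrix (Fin 3) (Fin 3) ℝ :=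
  !![Real.cos t, -Real.sin t, 0; Real.sin t, Real.cos t, 0; 0, 0, 1]

/-- The rotation by `t` about the `y` axis. -/
noncomputable def rotY (t : ℝ) : Matrix (Fin 3) (Fin 3) ℝ :=
  !![Real.cos t, 0, Real.sin t; 0, 1, 0; -Real.sin t, 0, Real.cos t]

/-- The polynomial `P_p(c)`, with `x = cos φ` and `y = cos ψ`. -/
noncomputable def polyP (p φ ψ : ℝ) : ℝ[X] :=
  C (-((1 + Real.cos φ ^ 2) * (1 + Real.cos ψ ^ 2))) * X ^ 2
    + C (2 * Real.cos φ * Real.cos ψ * Real.sin φ * Real.sin ψ) * X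
    + C (-(Real.cos φ ^ 2 * Real.cos ψ ^ 2 - 2 * Real.cos φ ^ 2 - 2 * Real.cos ψ ^ 2 + 3) - p)

/-- The polynomial `Q_q(c)`, with `x = cos φ` and `y = cos ψ`. -/
noncomputable def polyQ (q φ ψ : ℝ) : ℝ[X] :=
  C (2 * (1 - Real.cos φ ^ 2 * Real.cos ψ ^ 2)) * X ^ 2
    + C (4 * Real.cos φ * Real.cos ψ * Real.sin φ * Real.sin ψ) * X
    + C (-(2 * (1 - Real.cos φ ^ 2) * (1 - Real.cos ψ ^ 2)) - q)

/-- The expression `R(u, z; p, q)`, over any commutative ring. -/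
def resR {A : Type*} [CommRing A] (u z p q : A) : A :=
  4 * p ^ 2 * (1 - u * z) ^ 2 + 4 * p * q * (1 + u) * (1 + z) * (1 - u * z)
    - 8 * p * (-4 + 2 * (u + z) + (u + z) ^ 2 - 2 * u * z * (u + z) + u * z * (u - z) ^ 2)
    + q ^ 2 * ((1 + u * z) ^ 2 + (u + z) ^ 2 + 2 * u * z * (u + z) + 2 * (u + z))
    + 4 * q * (4 - u ^ 3 + 2 * u ^ 2 * z ^ 2 - z ^ 3 + 2 * (u + z) - u * z * (u + z)
        - 3 * (u + z) ^ 2 + 3 * u * z * (u ^ 2 + z ^ 2))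
    + 4 * (u ^ 4 - 8 * u ^ 3 * z - 2 * u ^ 2 * z ^ 2 - 8 * u * z ^ 3 + z ^ 4)
    + 16 * (u + z) ^ 3 - 16 * (u - z) ^ 2 + 64 * (-u - z + 1)

/-- `R(u, z; p, q)` as a polynomial in `u`. -/
noncomputable def polyR (z p q : ℝ) : ℝ[X] := resR X (C z) (C p) (C q)

/-- The integrand `∑ (2 + u + z) / |R'_u|`, summed over the distinct roots `u ∈ [0, 1]` of
`R(·, z; p, q)`; a multiple root contributes `∞`. -/
noncomputable def rootSum (z p q : ℝ) : ℝ≥0∞ :=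
  ∑' u : {u : ℝ // u ∈ Set.Icc (0 : ℝ) 1 ∧ (polyR z p q).IsRoot u},
    ENNReal.ofReal (2 + u + z) / ENNReal.ofReal |(derivative (polyR z p q)).eval (u : ℝ)|

/-- `(2 / π²) ∫₀¹ dz ∑ (2 + u + z) / |R'_u|`. -/
noncomputable def rhoFormula (p q : ℝ) : ℝ≥0∞ :=
  ENNReal.ofReal (2 / Real.pi ^ 2) * ∫⁻ z in Set.Icc (0 : ℝ) 1, rootSum z p q

end HornSymm

namespace HornSymm

/-! The Haar integral is pushed to angle coordinates, and the coefficients are then taken as new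
coordinates. Multiplying a rotation by z-rotations on both sides shifts `φ` and `ψ` and fixes the
entry `g₃₃ = cos θ`. Bi-invariance therefore allows averaging over both angles, and only the law of
`g₃₃` is needed: it is uniform on `[-1, 1]`. Reflections reduce the angles to `(0, π/2)`, which
gives `lintegral_PQ` and the constant `2 / π²`. The area formula `lintegral_mul_tsum_fiber` for `(ψ,
φ, c) ↦ (ψ, P, Q)` then exhibits the density as an integral over `ψ` of the sum of `1 / |jac|` over
a fiber.

It remains to match fibers with roots of `R`. Put `u = cos² φ`, `z = cos² ψ`, `b = cos φ cos ψ sin φ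
sin ψ`. In `P - Q/2` the linear term cancels, so `(2+u+z) c² = N` with `N = u+z-2-p+q/2`.
Substituting in `Q = q` gives `2b(2+u+z) c = A` with `A = (q/2+(1-u)(1-z))(2+u+z) - N(1-uz)`.
Eliminating `c` gives `A² = 4b²N(2+u+z)`, which is `R = 0`; conversely a root `u` with `b ≠ 0`
determines `c`. Since `Q ≥ 0` whenever `|c| ≥ 1`, a negative `q` forces `|c| < 1`, so almost surely
no root in `[0, 1]` is spurious (`exists_pq_eq_of_resR_eq_zero`). The weights agree because `∂R/∂u =
2 cos ψ sin ψ (2+u+z) jac` (`eval_derivative_polyR_eq_jac`) and `2 cos ψ sin ψ dψ = |dz|`.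

The symmetry in `q` comes from a rotation that conjugates `J_z` to `-J_z`. -/

/-! ### The characteristic polynomial of `C`, in matrix entries and in Euler angles. -/

theorem charpoly_fin_three {A : Type*} [CommRing A] (M : Matrix (Fin 3) (Fin 3) A) :
    M.charpoly = X ^ 3 - C (M 0 0 + M 1 1 + M 2 2) * X ^ 2
      + C (M 0 0 * M 1 1 - M 0 1 * M 1 0 + M 0 0 * M 2 2 - M 0 2 * M 2 0
          + M 1 1 * M 2 2 - M 1 2 * M 2 1) * X - C M.det := by
  simp only [Matrix.charpoly, Matrix.det_fin_three, Matrix.charmatrix_apply, Matrix.diagonal_apply]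
  simp
  ring

theorem sumC_apply (M : Matrix (Fin 3) (Fin 3) ℝ) (i j : Fin 3) :
    sumC M i j = Jz i j + M i 0 * M j 0 - M i 2 * M j 2 := by
  simp [sumC, Jz, Matrix.mul_apply, Fin.sum_univ_three, Matrix.diagonal_apply]
  ring

/-- The trace vanishes because the first and third columns have equal norm. Only squares of entries
survive in the coefficients, which later makes continuity, the bound on `Q` and the symmetry
immediate. -/
theorem charpoly_sumC {M : Matrix (Fin 3) (Fin 3) ℝ} (h1 : M * Mᵀ = 1) :
    (sumC M).charpoly = X ^ 3
      + C (-2 - (M 0 0 ^ 2 - M 0 2 ^ 2 - M 2 0 ^ 2 + M 2 2 ^ 2)) * X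
      + C (M 1 0 ^ 2 - M 1 2 ^ 2 + M 0 1 ^ 2 - M 2 1 ^ 2) := by
  have h2 : Mᵀ * M = 1 := mul_eq_one_comm.mp h1
  have r (i j : Fin 3) := congrFun (congrFun h1 i) j
  have c (i j : Fin 3) := congrFun (congrFun h2 i) j
  simp only [Matrix.mul_apply, Fin.sum_univ_three, Matrix.transpose_apply] at r c
  have c00 := c 0 0
  have c02 := c 0 2
  have c22 := c 2 2
  have r00 := r 0 0
  have r22 := r 2 2
  have r11 := r 1 1
  simp at c00 c02 c22 r00 r22 r11
  clear r c h1 h2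
  rw [charpoly_fin_three]
  have e1 : sumC M 0 0 + sumC M 1 1 + sumC M 2 2 = 0 := by
    simp only [sumC_apply, Jz, Matrix.diagonal_apply]
    simp
    linear_combination c00 - c22
  have e2 : sumC M 0 0 * sumC M 1 1 - sumC M 0 1 * sumC M 1 0 + sumC M 0 0 * sumC M 2 2
      - sumC M 0 2 * sumC M 2 0 + sumC M 1 1 * sumC M 2 2 - sumC M 1 2 * sumC M 2 1 =
      -2 - (M 0 0 ^ 2 - M 0 2 ^ 2 - M 2 0 ^ 2 + M 2 2 ^ 2) := by
    simp only [sumC_apply, Jz, Matrix.diagonal_apply]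
    simp
    generalize M 0 0 = a at *
    generalize M 1 0 = b at *
    generalize M 2 0 = d at *
    generalize M 0 2 = e at *
    generalize M 1 2 = f at *
    generalize M 2 2 = g at *
    clear r00 r22 r11
    grind
  have e3 : (sumC M).det = -(M 1 0 ^ 2 - M 1 2 ^ 2 + M 0 1 ^ 2 - M 2 1 ^ 2) := by
    have g1 : M 0 1 ^ 2 = 1 - M 0 0 ^ 2 - M 0 2 ^ 2 := by linear_combination r00
    have g2 : M 2 1 ^ 2 = 1 - M 2 0 ^ 2 - M 2 2 ^ 2 := by linear_combination r22
    rw [g1, g2]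
    simp only [Matrix.det_fin_three, sumC_apply, Jz, Matrix.diagonal_apply]
    simp
    generalize M 0 0 = a at *
    generalize M 1 0 = b at *
    generalize M 2 0 = d at *
    generalize M 0 2 = e at *
    generalize M 1 2 = f at *
    generalize M 2 2 = g at *
    clear r00 r22 r11 g1 g2
    grind
  rw [e1, e2, e3]
  simp only [map_neg, map_zero, zero_mul, sub_zero, sub_neg_eq_add]

theorem rotZ_mul_transpose (t : ℝ) : rotZ t * (rotZ t)ᵀ = 1 := by
  ext i j
  have := Real.sin_sq_add_cos_sq t
  fin_cases i <;> fin_cases j <;> simp [rotZ, Matrix.mul_apply, Fin.sum_univ_three] <;>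
    linarith

theorem rotY_mul_transpose (t : ℝ) : rotY t * (rotY t)ᵀ = 1 := by
  ext i j
  have := Real.sin_sq_add_cos_sq t
  fin_cases i <;> fin_cases j <;> simp [rotY, Matrix.mul_apply, Fin.sum_univ_three] <;>
    linarith

/-- The rotation with Euler angles `φ, θ, ψ`. -/
noncomputable def euler (φ θ ψ : ℝ) : Matrix (Fin 3) (Fin 3) ℝ := rotZ φ * rotY θ * rotZ ψ

theorem euler_mul_transpose (φ θ ψ : ℝ) : euler φ θ ψ * (euler φ θ ψ)ᵀ = 1 := by
  simp only [euler, Matrix.transpose_mul]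
  calc _ = rotZ φ * (rotY θ * (rotZ ψ * (rotZ ψ)ᵀ) * (rotY θ)ᵀ) * (rotZ φ)ᵀ := by
        simp only [Matrix.mul_assoc]
    _ = 1 := by simp [rotZ_mul_transpose, rotY_mul_transpose]

/-- `P` as a function of the Euler angles, with `c = cos θ`. -/
noncomputable def pFun (φ ψ c : ℝ) : ℝ := (polyP 0 φ ψ).eval c

/-- `Q` as a function of the Euler angles, with `c = cos θ`. -/
noncomputable def qFun (φ ψ c : ℝ) : ℝ := (polyQ 0 φ ψ).eval c

theorem pFun_eq (φ ψ c : ℝ) : pFun φ ψ c =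
    -((1 + Real.cos φ ^ 2) * (1 + Real.cos ψ ^ 2)) * c ^ 2
      + 2 * Real.cos φ * Real.cos ψ * Real.sin φ * Real.sin ψ * c
      - (Real.cos φ ^ 2 * Real.cos ψ ^ 2 - 2 * Real.cos φ ^ 2 - 2 * Real.cos ψ ^ 2 + 3) := by
  simp [pFun, polyP]
  ring

theorem qFun_eq (φ ψ c : ℝ) : qFun φ ψ c =
    2 * (1 - Real.cos φ ^ 2 * Real.cos ψ ^ 2) * c ^ 2
      + 4 * Real.cos φ * Real.cos ψ * Real.sin φ * Real.sin ψ * c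
      - 2 * (1 - Real.cos φ ^ 2) * (1 - Real.cos ψ ^ 2) := by
  simp [qFun, polyQ]
  ring

theorem charpoly_sumC_euler (φ θ ψ : ℝ) :
    (sumC (euler φ θ ψ)).charpoly =
      X ^ 3 + C (pFun φ ψ (Real.cos θ)) * X + C (qFun φ ψ (Real.cos θ)) := by
  rw [charpoly_sumC (euler_mul_transpose φ θ ψ), pFun_eq, qFun_eq]
  have h1 := Real.sin_sq φ
  have h2 := Real.sin_sq ψ
  have h3 := Real.sin_sq θ
  congr 2
  · congr 2
    simp [euler, rotZ, rotY, Matrix.mul_apply, Fin.sum_univ_three]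
    grind
  · simp [euler, rotZ, rotY, Matrix.mul_apply, Fin.sum_univ_three]
    grind

/-! ### Location of the roots of `Q_q`. -/

theorem abs_cos_mul_cos_add_sin_mul_sin_le (φ ψ : ℝ) :
    |Real.cos φ * Real.cos ψ + Real.sin φ * Real.sin ψ| ≤ 1 ∧
      |Real.cos φ * Real.cos ψ - Real.sin φ * Real.sin ψ| ≤ 1 := by
  rw [← Real.cos_sub, ← Real.cos_add]
  exact ⟨Real.abs_cos_le_one _, Real.abs_cos_le_one _⟩

theorem le_qFun_of_one_le_abs (φ ψ : ℝ) {c : ℝ} (hc : 1 ≤ |c|) :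
    2 * (1 - Real.cos φ ^ 2 * Real.cos ψ ^ 2) * (|c| - 1) ^ 2 ≤ qFun φ ψ c := by
  rw [qFun_eq, ← Real.sin_sq φ, mul_assoc 2 (Real.sin φ ^ 2), ← Real.sin_sq ψ]
  obtain ⟨h3, h4⟩ := abs_cos_mul_cos_add_sin_mul_sin_le φ ψ
  have hX : |Real.cos φ * Real.cos ψ| ≤ 1 := by
    rw [abs_mul]
    exact mul_le_one₀ (Real.abs_cos_le_one _) (abs_nonneg _) (Real.abs_cos_le_one _)
  have e : 2 * (1 - Real.cos φ ^ 2 * Real.cos ψ ^ 2) * c ^ 2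
      + 4 * Real.cos φ * Real.cos ψ * Real.sin φ * Real.sin ψ * c
      - 2 * (Real.sin φ ^ 2 * Real.sin ψ ^ 2) =
      2 * (1 - (Real.cos φ * Real.cos ψ) ^ 2) * c ^ 2
      + 4 * (Real.cos φ * Real.cos ψ) * (Real.sin φ * Real.sin ψ) * c
      - 2 * (Real.sin φ * Real.sin ψ) ^ 2 := by ring
  rw [e, ← mul_pow]
  generalize Real.cos φ * Real.cos ψ = x at *
  generalize Real.sin φ * Real.sin ψ = s at *
  rw [abs_le] at h3 h4 hX
  -- For `c ≥ 1` the difference of the two sides is `2(1-(x-s)²) + 4(c-1)(1-x(x-s))`. The case `c ≤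
  -- -1` is the same with `s` replaced by `-s`.
  have k1 : 0 ≤ 1 - (x - s) ^ 2 := by nlinarith
  have k2 : 0 ≤ 1 - (x + s) ^ 2 := by nlinarith
  have m1 : |x * (x - s)| ≤ 1 := by
    rw [abs_mul]
    exact mul_le_one₀ (abs_le.mpr hX) (abs_nonneg _) (abs_le.mpr h4)
  have m2 : |x * (x + s)| ≤ 1 := by
    rw [abs_mul]
    exact mul_le_one₀ (abs_le.mpr hX) (abs_nonneg _) (abs_le.mpr h3)
  rw [abs_le] at m1 m2
  rcases le_abs.mp hc with h | h
  · rw [abs_of_pos (by linarith)]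
    nlinarith [mul_nonneg (sub_nonneg.mpr h) (sub_nonneg.mpr m1.2)]
  · rw [abs_of_neg (by linarith)]
    nlinarith [mul_nonneg (sub_nonneg.mpr h) (sub_nonneg.mpr m2.2)]

theorem isRoot_polyQ_iff {q φ ψ c : ℝ} : (polyQ q φ ψ).IsRoot c ↔ qFun φ ψ c = q := by
  have : (polyQ q φ ψ).eval c = qFun φ ψ c - q := by
    simp [qFun, polyQ]
    ring
  rw [IsRoot.def, this, sub_eq_zero]

theorem isRoot_polyQ_mem_Icc {q φ ψ : ℝ} (hq : q ≤ 0) (h0 : polyQ q φ ψ ≠ 0) {c : ℝ}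
    (hc : (polyQ q φ ψ).IsRoot c) : c ∈ Set.Icc (-1 : ℝ) 1 := by
  rw [isRoot_polyQ_iff] at hc
  rw [Set.mem_Icc, ← abs_le]
  by_contra! h
  have h1 := le_qFun_of_one_le_abs φ ψ h.le
  have hx := Real.cos_sq_le_one φ
  have hy := Real.cos_sq_le_one ψ
  have hx' := sq_nonneg (Real.cos φ)
  have hy' := sq_nonneg (Real.cos ψ)
  -- The lower bound is strictly positive unless its leading coefficient vanishes. In that
  -- degenerate case `Q_q` is the constant `-q`, and having a root makes it zero.
  have hxy : Real.cos φ ^ 2 * Real.cos ψ ^ 2 = 1 := by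
    have : 0 < (|c| - 1) ^ 2 := by
      have := sub_pos.mpr h
      positivity
    nlinarith
  have ex : Real.cos φ ^ 2 = 1 := by nlinarith
  have ey : Real.cos ψ ^ 2 = 1 := by nlinarith
  have es : Real.sin φ = 0 := by
    rw [← sq_eq_zero_iff, Real.sin_sq, ex, sub_self]
  rw [qFun_eq, ex, ey, es] at hc
  have hq0 : q = 0 := by linarith
  apply h0
  simp [polyQ, ex, ey, es, hq0]

/-! ### The resultant `R` and its derivative in `u`. -/

theorem resultant_polyP_polyQ (p q φ ψ : ℝ) :
    resultant (polyP p φ ψ) (polyQ q φ ψ) 2 2 =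
      resR (Real.cos φ ^ 2) (Real.cos ψ ^ 2) p q := by
  have h1 := Real.sin_sq φ
  have h2 := Real.sin_sq ψ
  have key : ∀ a b c d e f : ℝ,
      resultant (C a * X ^ 2 + C b * X + C c) (C d * X ^ 2 + C e * X + C f) 2 2 =
      (a * f - c * d) ^ 2 - (a * e - b * d) * (b * f - c * e) := by
    intro a b c d e f
    simp [resultant, sylvester, Matrix.det_succ_row_zero, Fin.sum_univ_succ, Fin.succAbove,
      Fin.addCases, coeff_X, coeff_C]
    ring
  rw [polyP, polyQ, sub_eq_add_neg, key]
  rw [resR]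
  grind

theorem natDegree_polyR (z p q : ℝ) : (polyR z p q).natDegree = 4 := by
  have : polyR z p q = C 4 * X ^ 4 + C (-8 * p * z + 4 * q * (-1 + 3 * z) - 32 * z + 16) * X ^ 3
      + C (4 * p ^ 2 * z ^ 2 - 4 * p * q * (1 + z) * z - 8 * p * (1 - 2 * z - 2 * z ^ 2)
        + q ^ 2 * (1 + z) ^ 2 + 4 * q * (2 * z ^ 2 - z - 3) - 8 * z ^ 2 + 48 * z - 16) * X ^ 2
      + C (-8 * p ^ 2 * z + 4 * p * q * (1 + z) * (1 - z)
        - 8 * p * (2 + 2 * z - 2 * z ^ 2 + z ^ 3)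
        + q ^ 2 * (2 + 4 * z + 2 * z ^ 2) + 4 * q * (2 - z ^ 2 - 6 * z + 3 * z ^ 3)
        - 32 * z ^ 3 + 48 * z ^ 2 + 32 * z - 64) * X
      + C (4 * p ^ 2 + 4 * p * q * (1 + z) - 8 * p * (-4 + 2 * z + z ^ 2) + q ^ 2 * (1 + z) ^ 2
        + 4 * q * (4 - z ^ 3 + 2 * z - 3 * z ^ 2) + 4 * z ^ 4 + 16 * z ^ 3 - 16 * z ^ 2 + 64
        - 64 * z) := by
    simp only [polyR, resR, map_add, map_sub, map_mul, map_neg, map_pow, map_ofNat, map_one]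
    ring
  rw [this]
  compute_degree!

theorem resR_symm {A : Type*} [CommRing A] (u z p q : A) : resR u z p q = resR z u p q := by
  simp only [resR]
  ring

/-- This is `4(A² - 4b²N(2+u+z))` with `b² = u(1-u)z(1-z)`: the result of eliminating `c` from
`(2+u+z)c² = N` and `2b(2+u+z)c = A`. -/
theorem resR_eq (u z p q : ℝ) : resR u z p q =
    4 * (((q / 2 + (1 - u) * (1 - z)) * (2 + u + z) - (u + z - 2 - p + q / 2) * (1 - u * z)) ^ 2
      - 4 * u * (1 - u) * (z * (1 - z)) * (u + z - 2 - p + q / 2) * (2 + u + z)) := by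
  simp only [resR]
  ring

theorem eval_polyR (u z p q : ℝ) : (polyR z p q).eval u = resR u z p q := by
  simp [polyR, resR]
  ring

theorem eval_derivative_polyR (u z p q : ℝ) : (derivative (polyR z p q)).eval u =
    4 * (2 * ((q / 2 + (1 - u) * (1 - z)) * (2 + u + z)
          - (u + z - 2 - p + q / 2) * (1 - u * z)) *
        (-(1 - z) * (2 + u + z) + (q / 2 + (1 - u) * (1 - z)) - (1 - u * z)
          + (u + z - 2 - p + q / 2) * z)
      - 4 * (1 - 2 * u) * (z * (1 - z)) * (u + z - 2 - p + q / 2) * (2 + u + z)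
      - 4 * u * (1 - u) * (z * (1 - z)) * (2 + u + z)
      - 4 * u * (1 - u) * (z * (1 - z)) * (u + z - 2 - p + q / 2)) := by
  simp [polyR, resR, derivative_pow]
  ring

/-- The partial derivative of `P` with respect to `φ`. -/
noncomputable def pFunφ (φ ψ c : ℝ) : ℝ :=
  2 * Real.cos φ * Real.sin φ * (c ^ 2 * (1 + Real.cos ψ ^ 2) + Real.cos ψ ^ 2 - 2)
    + 2 * (2 * Real.cos φ ^ 2 - 1) * Real.cos ψ * Real.sin ψ * c

/-- The partial derivative of `P` with respect to `c`. -/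
noncomputable def pFunc (φ ψ c : ℝ) : ℝ :=
  -(2 * c * (1 + Real.cos φ ^ 2) * (1 + Real.cos ψ ^ 2))
    + 2 * Real.cos φ * Real.cos ψ * Real.sin φ * Real.sin ψ

/-- The partial derivative of `Q` with respect to `φ`. -/
noncomputable def qFunφ (φ ψ c : ℝ) : ℝ :=
  4 * Real.cos φ * Real.sin φ * (c ^ 2 * Real.cos ψ ^ 2 + Real.cos ψ ^ 2 - 1)
    + 4 * (2 * Real.cos φ ^ 2 - 1) * Real.cos ψ * Real.sin ψ * c

/-- The partial derivative of `Q` with respect to `c`. -/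
noncomputable def qFunc (φ ψ c : ℝ) : ℝ :=
  4 * c * (1 - Real.cos φ ^ 2 * Real.cos ψ ^ 2)
    + 4 * Real.cos φ * Real.cos ψ * Real.sin φ * Real.sin ψ

/-- The Jacobian determinant of `(φ, c) ↦ (P, Q)`. -/
noncomputable def jac (φ ψ c : ℝ) : ℝ :=
  pFunφ φ ψ c * qFunc φ ψ c - pFunc φ ψ c * qFunφ φ ψ c

/-- The factor `2 cos ψ sin ψ` is the Jacobian of `ψ ↦ z`, and `2 + u + z` is the numerator in
`rootSum`. Hence `1 / |jac|` becomes a summand of the density formula. -/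
theorem eval_derivative_polyR_eq_jac (φ ψ c : ℝ) :
    (derivative (polyR (Real.cos ψ ^ 2) (pFun φ ψ c) (qFun φ ψ c))).eval (Real.cos φ ^ 2) =
      2 * Real.cos ψ * Real.sin ψ * (2 + Real.cos φ ^ 2 + Real.cos ψ ^ 2) * jac φ ψ c := by
  rw [eval_derivative_polyR, jac, pFunφ, pFunc, qFunφ, qFunc, pFun_eq, qFun_eq]
  have h1 := Real.sin_sq φ
  have h2 := Real.sin_sq ψ
  generalize Real.cos φ = x at *
  generalize Real.sin φ = s at *
  generalize Real.cos ψ = y at *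
  generalize Real.sin ψ = t at *
  have hY : (2 * y * t) ^ 2 = 4 * (y ^ 2 * (1 - y ^ 2)) := by rw [mul_pow, h2]; ring
  have hβ : (2 * x * y * s * t) ^ 2 = 4 * x ^ 2 * (1 - x ^ 2) * (y ^ 2 * (1 - y ^ 2)) := by
    linear_combination x ^ 2 * s ^ 2 * hY + 4 * x ^ 2 * (y ^ 2 * (1 - y ^ 2)) * h1
  linear_combination (4 * (2 + x ^ 2 + y ^ 2) * (1 + c ^ 2)) * hβ
    - 4 * (2 * x ^ 2 - 1) * c ^ 2 * (2 + x ^ 2 + y ^ 2) ^ 2 * hY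

/-! ### Haar measure on `SO(3)` and the law of the entry `g₃₃`. -/

instance : SecondCountableTopology (Matrix (Fin 3) (Fin 3) ℝ) :=
  inferInstanceAs (SecondCountableTopology (Fin 3 → Fin 3 → ℝ))

instance : SecondCountableTopology SO3 := TopologicalSpace.Subtype.secondCountableTopology _

instance : IsProbabilityMeasure haarSO3 := ⟨by
  rw [haarSO3, ← TopologicalSpace.PositiveCompacts.coe_top (α := SO3)]
  exact Measure.haarMeasure_self⟩

instance : haarSO3.IsHaarMeasure := by
  unfold haarSO3
  infer_instance

/-- A right translate of Haar measure is again a left-invariant probability measure, so uniqueness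
identifies the two. -/
instance : haarSO3.IsMulRightInvariant := ⟨fun g => by
  have : IsProbabilityMeasure (Measure.map (· * g) haarSO3) :=
    Measure.isProbabilityMeasure_map (measurable_mul_const g).aemeasurable
  have h := Measure.haarMeasure_unique (Measure.map (· * g) haarSO3)
    (⊤ : TopologicalSpace.PositiveCompacts SO3)
  rw [TopologicalSpace.PositiveCompacts.coe_top, measure_univ, one_smul] at h
  exact h⟩

/-- The entries of a rotation matrix. -/
def entry (i j : Fin 3) (g : SO3) : ℝ := (g : Matrix (Fin 3) (Fin 3) ℝ) i j

@[fun_prop]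
theorem continuous_entry (i j : Fin 3) : Continuous (entry i j) :=
  continuous_subtype_val.matrix_elem i j

theorem mul_transpose_SO3 (g : SO3) :
    (g : Matrix (Fin 3) (Fin 3) ℝ) * (g : Matrix (Fin 3) (Fin 3) ℝ)ᵀ = 1 := by
  have h := (Matrix.mem_specialOrthogonalGroup_iff.mp g.2).1
  rw [Matrix.mem_orthogonalGroup_iff] at h
  simpa [Matrix.star_eq_conjTranspose] using h

theorem transpose_mul_SO3 (g : SO3) :
    (g : Matrix (Fin 3) (Fin 3) ℝ)ᵀ * (g : Matrix (Fin 3) (Fin 3) ℝ) = 1 :=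
  mul_eq_one_comm.mp (mul_transpose_SO3 g)

/-- The element of `SO(3)` given by a matrix with orthonormal rows and determinant one. -/
def mkSO3 (M : Matrix (Fin 3) (Fin 3) ℝ) (h : M * Mᵀ = 1) (hd : M.det = 1) : SO3 :=
  ⟨M, Matrix.mem_specialOrthogonalGroup_iff.mpr
    ⟨(Matrix.mem_orthogonalGroup_iff _ _).mpr (by simpa [Matrix.star_eq_conjTranspose] using h), hd⟩⟩

theorem det_rotZ (t : ℝ) : (rotZ t).det = 1 := by
  have := Real.sin_sq_add_cos_sq t
  simp [rotZ, Matrix.det_fin_three]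
  linarith

theorem det_rotY (t : ℝ) : (rotY t).det = 1 := by
  have := Real.sin_sq_add_cos_sq t
  simp [rotY, Matrix.det_fin_three]
  linarith

/-- `rotZ t` as an element of `SO(3)`. -/
noncomputable def rZ (t : ℝ) : SO3 := mkSO3 (rotZ t) (rotZ_mul_transpose t) (det_rotZ t)

/-- `rotY t` as an element of `SO(3)`. -/
noncomputable def rY (t : ℝ) : SO3 := mkSO3 (rotY t) (rotY_mul_transpose t) (det_rotY t)

@[simp] theorem coe_rZ (t : ℝ) : (rZ t : Matrix (Fin 3) (Fin 3) ℝ) = rotZ t := rfl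

@[simp] theorem coe_rY (t : ℝ) : (rY t : Matrix (Fin 3) (Fin 3) ℝ) = rotY t := rfl

theorem continuous_rotZ : Continuous rotZ := by
  refine continuous_matrix fun i j => ?_
  fin_cases i <;> fin_cases j <;> simp [rotZ] <;> fun_prop

theorem continuous_rZ : Continuous rZ := continuous_rotZ.subtype_mk _

theorem col_two_norm (g : SO3) : entry 0 2 g ^ 2
    + entry 1 2 g ^ 2 + entry 2 2 g ^ 2 = 1 := by
  have := congrFun (congrFun (transpose_mul_SO3 g) 2) 2
  simp [Matrix.mul_apply, Fin.sum_univ_three] at this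
  simp only [entry]
  linarith

theorem abs_entry_le (g : SO3) (i : Fin 3) : |entry i 2 g| ≤ 1 := by
  have := col_two_norm g
  rw [← sq_le_one_iff_abs_le_one]
  have h0 := sq_nonneg (entry 0 2 g)
  have h1 := sq_nonneg (entry 1 2 g)
  have h2 := sq_nonneg (entry 2 2 g)
  fin_cases i <;> simp only [Fin.zero_eta, Fin.mk_one, Fin.reduceFinMk] <;> linarith

theorem integrable_SO3 {f : SO3 → ℝ} (hf : Continuous f) : Integrable f haarSO3 :=
  hf.integrable_of_hasCompactSupport (HasCompactSupport.of_compactSpace f)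

/-- Invariance under infinitesimal rotations about the `y` axis. -/
theorem integral_rotY_infinitesimal (n : ℕ) :
    ∫ g : SO3, entry 2 2 g * entry 2 2 g ^ (n + 1)
      - (n + 1) * entry 0 2 g ^ 2
        * entry 2 2 g ^ n ∂haarSO3 = 0 := by
  set F : ℝ → SO3 → ℝ := fun t g =>
    (Real.cos t * entry 0 2 g
      + Real.sin t * entry 2 2 g) *
    (-Real.sin t * entry 0 2 g
      + Real.cos t * entry 2 2 g) ^ (n + 1) with hF
  set F' : ℝ → SO3 → ℝ := fun t g =>
    (-Real.sin t * entry 0 2 g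
      + Real.cos t * entry 2 2 g) *
    (-Real.sin t * entry 0 2 g
      + Real.cos t * entry 2 2 g) ^ (n + 1) +
    (Real.cos t * entry 0 2 g
      + Real.sin t * entry 2 2 g) *
    (((n + 1 : ℕ) : ℝ) * (-Real.sin t * entry 0 2 g
      + Real.cos t * entry 2 2 g) ^ n *
      (-Real.cos t * entry 0 2 g
      + -Real.sin t * entry 2 2 g)) with hF'
  -- `F t` is `F 0` composed with left translation by `rY t`, so its integral is constant in `t`.
  -- The claim is the vanishing of the derivative at `t = 0`.
  have hconst : ∀ t, ∫ g, F t g ∂haarSO3 = ∫ g, F 0 g ∂haarSO3 := by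
    intro t
    rw [← integral_mul_left_eq_self (F 0) (rY t)]
    congr 1
    ext g
    simp [hF, entry, rotY, Matrix.mul_apply, Fin.sum_univ_three]
  have hcF (t : ℝ) : Continuous (F t) := by simp only [hF]; fun_prop
  have hcF' (t : ℝ) : Continuous (F' t) := by simp only [hF']; fun_prop
  have hb (a b : ℝ) (ha : |a| ≤ 1) (hb : |b| ≤ 1) (g : SO3) :
      |a * entry 0 2 g + b * entry 2 2 g| ≤ 2 := by
    refine (abs_add_le _ _).trans ?_
    rw [abs_mul, abs_mul]
    have h1 := mul_le_one₀ ha (abs_nonneg _) (abs_entry_le g 0)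
    have h2 := mul_le_one₀ hb (abs_nonneg _) (abs_entry_le g 2)
    linarith
  have key := hasDerivAt_integral_of_dominated_loc_of_deriv_le (μ := haarSO3) (F := F) (F' := F')
    (x₀ := 0) (s := Set.univ) (bound := fun _ => 2 * 2 ^ (n + 1) + 2 * ((n + 1 : ℕ) * 2 ^ n * 2))
    Filter.univ_mem (Filter.Eventually.of_forall fun t => (hcF t).aestronglyMeasurable)
    (integrable_SO3 (hcF 0)) (hcF' 0).aestronglyMeasurable
    (Filter.Eventually.of_forall fun g t _ => ?_) (integrable_const _)
    (Filter.Eventually.of_forall fun g t _ => ?_)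
  · have h1 := key.2
    simp only [hconst] at h1
    have h2 := h1.unique (hasDerivAt_const (0 : ℝ) _)
    rw [← h2]
    congr 1
    ext g
    simp [hF']
    ring
  · have hc := Real.abs_cos_le_one t
    have hs := Real.abs_sin_le_one t
    have hc' : |-Real.cos t| ≤ 1 := by rwa [abs_neg]
    have hs' : |-Real.sin t| ≤ 1 := by rwa [abs_neg]
    rw [Real.norm_eq_abs]
    refine (abs_add_le _ _).trans ?_
    simp only [abs_mul, abs_pow, Nat.abs_cast]
    have b1 := hb _ _ hs' hc g
    have b2 := hb _ _ hc hs g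
    have b3 := hb _ _ hc' hs' g
    gcongr
  · have hc := Real.hasDerivAt_cos t
    have hs := Real.hasDerivAt_sin t
    have d1 := (hc.mul_const (entry 0 2 g)).add
      (hs.mul_const (entry 2 2 g))
    have d2 := (hs.neg.mul_const (entry 0 2 g)).add
      (hc.mul_const (entry 2 2 g))
    exact d1.mul (d2.pow (n + 1))

/-- A quarter turn about the z axis sends `(g₁₃, g₂₃)` to `(-g₂₃, g₁₃)`. -/
theorem integral_entry_sq_swap (n : ℕ) :
    ∫ g : SO3, entry 1 2 g ^ 2
        * entry 2 2 g ^ n ∂haarSO3 =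
      ∫ g : SO3, entry 0 2 g ^ 2
        * entry 2 2 g ^ n ∂haarSO3 := by
  rw [← integral_mul_left_eq_self _ (rZ (Real.pi / 2))]
  simp [entry, rotZ, Matrix.mul_apply, Fin.sum_univ_three]

/-- The moments of the entry `g₃₃` of a Haar distributed rotation. -/
theorem moment_recurrence (n : ℕ) :
    (n + 3 : ℝ) * ∫ g : SO3, entry 2 2 g ^ (n + 2) ∂haarSO3 =
      (n + 1) * ∫ g : SO3, entry 2 2 g ^ n ∂haarSO3 := by
  have h1 := integral_rotY_infinitesimal n
  rw [integral_sub (integrable_SO3 (by fun_prop)) (integrable_SO3 (by fun_prop))] at h1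
  simp only [mul_assoc, integral_const_mul, ← pow_succ'] at h1
  have h2 := integral_entry_sq_swap n
  -- The unit norm of the third column, multiplied by `g₃₃ ^ n` and integrated.
  have h3 : ∫ g : SO3, entry 2 2 g ^ n ∂haarSO3 =
      ∫ g : SO3, entry 0 2 g ^ 2
        * entry 2 2 g ^ n ∂haarSO3 +
      (∫ g : SO3, entry 1 2 g ^ 2
        * entry 2 2 g ^ n ∂haarSO3 +
      ∫ g : SO3, entry 2 2 g ^ (n + 2) ∂haarSO3) := by
    rw [← integral_add (integrable_SO3 (by fun_prop)) (integrable_SO3 (by fun_prop)),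
      ← integral_add (integrable_SO3 (by fun_prop)) (integrable_SO3 (by fun_prop))]
    congr 1
    ext g
    linear_combination -entry 2 2 g ^ n * col_two_norm g
  rw [h2] at h3
  linear_combination 2 * h1 - (n + 1 : ℝ) * h3

theorem moment_one : ∫ g : SO3, entry 2 2 g ∂haarSO3 = 0 := by
  have h : ∫ g : SO3, entry 2 2 g ∂haarSO3 =
      ∫ g : SO3, -entry 2 2 g ∂haarSO3 := by
    rw [← integral_mul_left_eq_self _ (rY Real.pi)]
    simp [entry, rotY, Matrix.mul_apply, Fin.sum_univ_three]
  rw [integral_neg] at h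
  linarith

theorem moment_eq (n : ℕ) :
    ∫ g : SO3, entry 2 2 g ^ n ∂haarSO3 =
      (1 / 2) * ∫ c in (-1 : ℝ)..1, c ^ n := by
  induction n using Nat.twoStepInduction with
  | zero => simp; norm_num
  | one => simp [moment_one]
  | more n ih _ =>
    have h := moment_recurrence n
    rw [ih] at h
    rw [integral_pow] at h ⊢
    have h3 : (n + 3 : ℝ) ≠ 0 := by positivity
    have h1 : (n + 1 : ℝ) ≠ 0 := by positivity
    apply mul_left_cancel₀ h3
    rw [h]
    push_cast
    field_simp
    ring

/-- The entry `g₃₃` of a Haar distributed rotation is uniformly distributed on `[-1, 1]`. -/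
theorem map_entry_two_two :
    Measure.map (fun g : SO3 => entry 2 2 g) haarSO3 =
      (2⁻¹ : ℝ≥0∞) • volume.restrict (Set.Icc (-1 : ℝ) 1) := by
  have hm := (continuous_entry 2 2).measurable
  have hp : IsProbabilityMeasure
      (Measure.map (fun g : SO3 => entry 2 2 g) haarSO3) :=
    Measure.isProbabilityMeasure_map hm.aemeasurable
  have hfin : IsFiniteMeasure ((2⁻¹ : ℝ≥0∞) • volume.restrict (Set.Icc (-1 : ℝ) 1)) :=
    Measure.smul_finite _ (by simp)
  apply ext_of_forall_integral_eq_of_IsFiniteMeasure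
  intro f
  rw [integral_map hm.aemeasurable f.continuous.aestronglyMeasurable, integral_smul_measure,
    integral_Icc_eq_integral_Ioc, ← intervalIntegral.integral_of_le (by norm_num)]
  have hpoly (p : ℝ[X]) : ∫ g : SO3, p.eval (entry 2 2 g) ∂haarSO3 =
      (1 / 2) * ∫ c in (-1 : ℝ)..1, p.eval c := by
    induction p using Polynomial.induction_on' with
    | add p q hp hq =>
      simp only [eval_add]
      rw [integral_add (integrable_SO3 (by fun_prop)) (integrable_SO3 (by fun_prop)),
        intervalIntegral.integral_add (Continuous.intervalIntegrable (by fun_prop) _ _)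
        (Continuous.intervalIntegrable (by fun_prop) _ _), hp, hq, mul_add]
    | monomial n a =>
      simp only [eval_monomial, integral_const_mul, moment_eq,
        intervalIntegral.integral_const_mul]
      ring
  simp only [ENNReal.toReal_inv, ENNReal.toReal_ofNat, smul_eq_mul]
  refine eq_of_forall_dist_le fun ε hε => ?_
  -- Equality of moments passes to continuous test functions by Weierstrass approximation on `[-1,
  -- 1]`.
  obtain ⟨p, hp⟩ := exists_polynomial_near_of_continuousOn (-1) 1 f f.continuous.continuousOn
    (ε / 2) (half_pos hε)
  have e1 : dist (∫ g : SO3, f (entry 2 2 g) ∂haarSO3)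
      (∫ g : SO3, p.eval (entry 2 2 g) ∂haarSO3) ≤ ε / 2 := by
    rw [dist_comm, dist_eq_norm, ← integral_sub (integrable_SO3 (by fun_prop))
      (integrable_SO3 (by fun_prop))]
    refine (norm_integral_le_of_norm_le_const (C := ε / 2)
      (Filter.Eventually.of_forall fun g => ?_)).trans (by simp)
    exact (hp _ (abs_le.mp (abs_entry_le g 2))).le
  have e2 : dist (1 / 2 * ∫ c in (-1 : ℝ)..1, p.eval c) (2⁻¹ * ∫ c in (-1 : ℝ)..1, f c)
      ≤ ε / 2 := by
    rw [one_div, dist_eq_norm, ← mul_sub, ← intervalIntegral.integral_sub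
      (Continuous.intervalIntegrable (by fun_prop) _ _)
      (Continuous.intervalIntegrable (by fun_prop) _ _), norm_mul]
    have := intervalIntegral.norm_integral_le_of_norm_le_const (a := (-1 : ℝ)) (b := 1)
      (f := fun c => p.eval c - f c) (C := ε / 2) fun c hc => by
        rw [Set.uIoc_of_le (by norm_num)] at hc
        exact (hp c ⟨hc.1.le, hc.2⟩).le
    norm_num at this ⊢
    linarith
  rw [hpoly] at e1
  linarith [dist_triangle (∫ g : SO3, f (entry 2 2 g) ∂haarSO3)
    (1 / 2 * ∫ c in (-1 : ℝ)..1, p.eval c) (2⁻¹ * ∫ c in (-1 : ℝ)..1, f c)]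

/-! ### Existence of Euler angles and the effect of z-rotations on `(P, Q)`. -/

theorem exists_polar {a b r : ℝ} (hr : 0 ≤ r) (h : a ^ 2 + b ^ 2 = r ^ 2) :
    ∃ t : ℝ, a = r * Real.cos t ∧ b = r * Real.sin t := by
  have hn : ‖(⟨a, b⟩ : ℂ)‖ = r := by
    rw [← sq_eq_sq₀ (norm_nonneg _) hr, ← Complex.normSq_eq_norm_sq, Complex.normSq_mk]
    linarith
  refine ⟨Complex.arg ⟨a, b⟩, ?_, ?_⟩
  · rw [← hn, Complex.norm_mul_cos_arg]
  · rw [← hn, Complex.norm_mul_sin_arg]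

theorem exists_eq_rotZ {M : Matrix (Fin 3) (Fin 3) ℝ} (h1 : M * Mᵀ = 1) (hd : M.det = 1)
    (h02 : M 0 2 = 0) (h12 : M 1 2 = 0) (h22 : M 2 2 = 1) : ∃ t, M = rotZ t := by
  have r := congrFun (congrFun h1 2) 2
  have h2 : Mᵀ * M = 1 := mul_eq_one_comm.mp h1
  have c0 := congrFun (congrFun h2 0) 0
  have c1 := congrFun (congrFun h2 0) 1
  simp [Matrix.mul_apply, Fin.sum_univ_three, h22] at r c0 c1
  have h20 : M 2 0 = 0 := by nlinarith
  have h21 : M 2 1 = 0 := by nlinarith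
  rw [Matrix.det_fin_three, h02, h12, h22, h20, h21] at hd
  rw [h20] at c0 c1
  obtain ⟨t, ht, ht'⟩ := exists_polar (a := M 0 0) (b := M 1 0) (r := 1) zero_le_one
    (by linarith)
  have e1 : M 1 1 = M 0 0 := by linear_combination M 0 0 * hd + M 1 0 * c1 - M 1 1 * c0
  have e2 : M 0 1 = -M 1 0 := by linear_combination -M 1 0 * hd + M 0 0 * c1 - M 0 1 * c0
  refine ⟨t, ?_⟩
  rw [one_mul] at ht ht'
  ext i j
  fin_cases i <;> fin_cases j <;>
    simp [rotZ, h20, h21, h02, h12, h22, e1, e2, ht, ht']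

theorem rotZ_mul_rotZ (s t : ℝ) : rotZ s * rotZ t = rotZ (s + t) := by
  ext i j
  fin_cases i <;> fin_cases j <;>
    simp [rotZ, Matrix.mul_apply, Fin.sum_univ_three, Real.cos_add, Real.sin_add] <;> ring

/-- Every rotation has Euler angles. -/
theorem exists_eq_euler (g : SO3) : ∃ φ θ ψ : ℝ,
    (g : Matrix (Fin 3) (Fin 3) ℝ) = euler φ θ ψ ∧ Real.cos θ = entry 2 2 g := by
  have hn := col_two_norm g
  have hc := abs_le.mp (abs_entry_le g 2)
  set θ := Real.arccos (entry 2 2 g)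
  have hcos : Real.cos θ = entry 2 2 g := Real.cos_arccos hc.1 hc.2
  have hs : 0 ≤ Real.sin θ := Real.sin_nonneg_of_nonneg_of_le_pi (Real.arccos_nonneg _)
    (Real.arccos_le_pi _)
  -- The third column in spherical coordinates gives `φ` and `θ`. Undoing these two rotations leaves
  -- one that fixes the z axis, whose angle is `ψ`.
  obtain ⟨φ, h0, h1⟩ := exists_polar hs (a := entry 0 2 g) (b := entry 1 2 g) (by
    rw [Real.sin_sq, hcos]
    linarith)
  have hφ := Real.sin_sq_add_cos_sq φ
  have hθ := Real.sin_sq_add_cos_sq θ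
  have hk : ((rY θ)⁻¹ * (rZ φ)⁻¹ * g : SO3) = (rotY θ)ᵀ * (rotZ φ)ᵀ *
      (g : Matrix (Fin 3) (Fin 3) ℝ) := rfl
  obtain ⟨ψ, hψ⟩ := exists_eq_rotZ (mul_transpose_SO3 ((rY θ)⁻¹ * (rZ φ)⁻¹ * g))
    (Matrix.mem_specialOrthogonalGroup_iff.mp ((rY θ)⁻¹ * (rZ φ)⁻¹ * g).2).2
    (by
      rw [hk]
      simp only [entry] at h0 h1 hcos
      simp [rotY, rotZ, Matrix.mul_apply, Fin.sum_univ_three, h0, h1, ← hcos]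
      linear_combination Real.cos θ * Real.sin θ * hφ)
    (by
      rw [hk]
      simp only [entry] at h0 h1 hcos
      simp [rotY, rotZ, Matrix.mul_apply, Fin.sum_univ_three, h0, h1, ← hcos]
      ring)
    (by
      rw [hk]
      simp only [entry] at h0 h1 hcos
      simp [rotY, rotZ, Matrix.mul_apply, Fin.sum_univ_three, h0, h1, ← hcos]
      linear_combination Real.sin θ ^ 2 * hφ + hθ)
  refine ⟨φ, θ, ψ, ?_, hcos⟩
  rw [euler, ← hψ, hk, Matrix.mul_assoc, ← Matrix.mul_assoc (rotY θ), ← Matrix.mul_assoc (rotY θ),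
    rotY_mul_transpose, Matrix.one_mul, ← Matrix.mul_assoc, rotZ_mul_transpose, Matrix.one_mul]

/-- `(P, Q)` as a function of the Euler angles, with `c = cos θ`. -/
noncomputable def pq (φ ψ c : ℝ) : ℝ × ℝ := (pFun φ ψ c, qFun φ ψ c)

theorem PQ_of_eq_euler {g : SO3} {φ θ ψ : ℝ}
    (h : (g : Matrix (Fin 3) (Fin 3) ℝ) = euler φ θ ψ) : PQ g = pq φ ψ (Real.cos θ) := by
  rw [PQ, h, charpoly_sumC_euler, pq]
  congr 1 <;> simp [coeff_X, coeff_C]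

theorem exists_PQ_rZ_mul (g : SO3) : ∃ φ ψ : ℝ, ∀ a b : ℝ,
    PQ (rZ a * g * rZ b) = pq (a + φ) (b + ψ) (entry 2 2 g) := by
  obtain ⟨φ, θ, ψ, h, hc⟩ := exists_eq_euler g
  refine ⟨φ, ψ, fun a b => ?_⟩
  rw [← hc]
  apply PQ_of_eq_euler
  rw [add_comm b, euler, ← rotZ_mul_rotZ, ← rotZ_mul_rotZ]
  change rotZ a * (g : Matrix (Fin 3) (Fin 3) ℝ) * rotZ b = _
  rw [h, euler]
  simp only [Matrix.mul_assoc]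

theorem PQ_eq (g : SO3) : PQ g =
    (-2 - (entry 0 0 g ^ 2 - entry 0 2 g ^ 2 - entry 2 0 g ^ 2 + entry 2 2 g ^ 2),
      entry 1 0 g ^ 2 - entry 1 2 g ^ 2 + entry 0 1 g ^ 2 - entry 2 1 g ^ 2) := by
  rw [PQ, charpoly_sumC (mul_transpose_SO3 g)]
  congr 1
  · simp [coeff_C, -map_sub, -map_neg, -map_add, -map_pow]
    simp [entry]
  · simp [coeff_C, -map_sub, -map_neg, -map_add, -map_pow]
    simp [entry]

theorem continuous_PQ : Continuous PQ := by
  rw [funext PQ_eq]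
  fun_prop

theorem continuous_pq : Continuous fun x : ℝ × ℝ × ℝ => pq x.1 x.2.1 x.2.2 := by
  simp only [pq, pFun_eq, qFun_eq]
  fun_prop

theorem pq_add_pi_left (φ ψ c : ℝ) : pq (φ + Real.pi) ψ c = pq φ ψ c := by
  simp [pq, pFun_eq, qFun_eq]

theorem pq_add_pi_right (φ ψ c : ℝ) : pq φ (ψ + Real.pi) c = pq φ ψ c := by
  simp [pq, pFun_eq, qFun_eq]

theorem pq_pi_sub_left (φ ψ c : ℝ) : pq (Real.pi - φ) ψ c = pq φ ψ (-c) := by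
  simp [pq, pFun_eq, qFun_eq]

theorem pq_pi_sub_right (φ ψ c : ℝ) : pq φ (Real.pi - ψ) c = pq φ ψ (-c) := by
  simp [pq, pFun_eq, qFun_eq]

/-! ### The Haar integral as an integral over the angles. -/

theorem setLIntegral_Ioc_add_of_periodic {T : ℝ} (hT : 0 < T) {f : ℝ → ℝ≥0∞}
    (hf : Function.Periodic f T) (s : ℝ) :
    ∫⁻ x in Set.Ioc 0 T, f (x + s) = ∫⁻ x in Set.Ioc 0 T, f x := by
  have h1 := (measurePreserving_add_right (volume : Measure ℝ) s).setLIntegral_comp_preimage_emb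
    (measurableEmbedding_addRight s) f (Set.Ioc s (s + T))
  have h2 : (fun x => x + s) ⁻¹' Set.Ioc s (s + T) = Set.Ioc 0 T := by
    ext x
    simp only [Set.mem_preimage, Set.mem_Ioc]
    constructor <;> rintro ⟨h, h'⟩ <;> constructor <;> linarith
  rw [h2] at h1
  have h3 := (isAddFundamentalDomain_Ioc hT s).setLIntegral_eq (isAddFundamentalDomain_Ioc hT 0) f
    hf.map_vadd_zmultiples
  rw [zero_add] at h3
  rw [h1, h3]

theorem setLIntegral_Ioc_of_reflect {T : ℝ} (hT : 0 < T) {f : ℝ → ℝ≥0∞}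
    (hf : ∀ x, f (T - x) = f x) :
    ∫⁻ x in Set.Ioc 0 T, f x = 2 * ∫⁻ x in Set.Ioo 0 (T / 2), f x := by
  have h1 := (Measure.measurePreserving_sub_left (volume : Measure ℝ) T).setLIntegral_comp_preimage_emb
    (MeasurableEquiv.subLeft T).measurableEmbedding f (Set.Ioc (T / 2) T)
  have h2 : (fun x => T - x) ⁻¹' Set.Ioc (T / 2) T = Set.Ico 0 (T / 2) := by
    ext x
    simp only [Set.mem_preimage, Set.mem_Ioc, Set.mem_Ico]
    constructor <;> rintro ⟨h, h'⟩ <;> constructor <;> linarith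
  rw [h2] at h1
  simp only [hf] at h1
  rw [← Set.Ioc_union_Ioc_eq_Ioc (b := T / 2) (by linarith) (by linarith),
    lintegral_union measurableSet_Ioc (Set.Ioc_disjoint_Ioc_of_le le_rfl), ← h1,
    setLIntegral_congr Ioo_ae_eq_Ioc.symm, setLIntegral_congr Ioo_ae_eq_Ico.symm, two_mul]

/-- Averaging over z-rotations on both sides replaces the full Haar measure in Euler angles: after
Tonelli, only the distribution of `g₃₃` is still to be inserted. -/
theorem pi_mul_pi_mul_lintegral_PQ {f : ℝ × ℝ → ℝ≥0∞} (hf : Measurable f) :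
    ENNReal.ofReal Real.pi * (ENNReal.ofReal Real.pi * ∫⁻ g, f (PQ g) ∂haarSO3) =
      ∫⁻ g, (∫⁻ ψ in Set.Ioc 0 Real.pi, ∫⁻ φ in Set.Ioc 0 Real.pi,
        f (pq φ ψ (entry 2 2 g))) ∂haarSO3 := by
  have hpi := Real.pi_pos
  have hZ := continuous_rZ
  have hPQ := continuous_PQ
  calc _ = ∫⁻ b in Set.Ioc 0 Real.pi, ∫⁻ a in Set.Ioc 0 Real.pi, ∫⁻ g : SO3,
        f (PQ (rZ a * g * rZ b)) ∂haarSO3 := by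
        have (a b : ℝ) : ∫⁻ g : SO3, f (PQ (rZ a * g * rZ b)) ∂haarSO3 =
            ∫⁻ g, f (PQ g) ∂haarSO3 := by
          rw [lintegral_mul_left_eq_self (fun g => f (PQ (g * rZ b))) (rZ a),
            lintegral_mul_right_eq_self (fun g => f (PQ g)) (rZ b)]
        simp [this, mul_comm]
    _ = ∫⁻ b in Set.Ioc 0 Real.pi, ∫⁻ g : SO3, (∫⁻ a in Set.Ioc 0 Real.pi,
        f (PQ (rZ a * g * rZ b))) ∂haarSO3 := by
        refine lintegral_congr fun b => lintegral_lintegral_swap ?_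
        exact (hf.comp (Continuous.measurable (f := fun x : ℝ × SO3 => PQ (rZ x.1 * x.2 * rZ b))
          (by fun_prop))).aemeasurable
    _ = ∫⁻ g : SO3, (∫⁻ b in Set.Ioc 0 Real.pi, ∫⁻ a in Set.Ioc 0 Real.pi,
        f (PQ (rZ a * g * rZ b))) ∂haarSO3 := by
        refine lintegral_lintegral_swap (Measurable.aemeasurable ?_)
        refine Measurable.lintegral_prod_right' (f := fun x : (ℝ × SO3) × ℝ =>
          f (PQ (rZ x.2 * x.1.2 * rZ x.1.1))) ?_
        exact hf.comp (Continuous.measurable (f := fun x : (ℝ × SO3) × ℝ =>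
          PQ (rZ x.2 * x.1.2 * rZ x.1.1)) (by fun_prop))
    _ = _ := by
        refine lintegral_congr fun g => ?_
        -- The Euler angles of `g` are offsets of the integration variables, absorbed by
        -- `π`-periodicity; no measurable choice of them is needed.
        obtain ⟨φ, ψ, h⟩ := exists_PQ_rZ_mul g
        simp only [h]
        rw [setLIntegral_Ioc_add_of_periodic hpi (f := fun b => ∫⁻ a in Set.Ioc 0 Real.pi,
          f (pq (a + φ) b (entry 2 2 g))) (fun b => by simp only [pq_add_pi_right])]
        refine lintegral_congr fun b => ?_
        rw [setLIntegral_Ioc_add_of_periodic hpi (f := fun a => f (pq a b (entry 2 2 g)))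
          (fun a => by simp only [pq_add_pi_left])]

theorem lintegral_PQ {f : ℝ × ℝ → ℝ≥0∞} (hf : Measurable f) :
    ∫⁻ g, f (PQ g) ∂haarSO3 = ENNReal.ofReal (2 / Real.pi ^ 2) *
      ∫⁻ ψ in Set.Ioo 0 (Real.pi / 2), ∫⁻ φ in Set.Ioo 0 (Real.pi / 2),
        ∫⁻ c in Set.Ioo (-1 : ℝ) 1, f (pq φ ψ c) := by
  have hpi := Real.pi_pos
  have hm : Measurable fun x : ℝ × ℝ × ℝ => f (pq x.1 x.2.1 x.2.2) :=
    hf.comp continuous_pq.measurable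
  set H : ℝ → ℝ≥0∞ := fun c => ∫⁻ ψ in Set.Ioc 0 Real.pi, ∫⁻ φ in Set.Ioc 0 Real.pi,
    f (pq φ ψ c) with hH
  have hHm : Measurable H := by
    refine Measurable.lintegral_prod_right' (f := fun x : ℝ × ℝ =>
      ∫⁻ φ in Set.Ioc 0 Real.pi, f (pq φ x.2 x.1)) ?_
    refine Measurable.lintegral_prod_right' (f := fun x : (ℝ × ℝ) × ℝ =>
      f (pq x.2 x.1.2 x.1.1)) ?_
    exact hm.comp (measurable_snd.prodMk
      ((measurable_snd.comp measurable_fst).prodMk (measurable_fst.comp measurable_fst)))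
  have e1 := pi_mul_pi_mul_lintegral_PQ hf
  have e2 : ∫⁻ g, H (entry 2 2 g) ∂haarSO3 = 2⁻¹ * ∫⁻ c in Set.Icc (-1 : ℝ) 1, H c := by
    rw [← lintegral_map hHm (continuous_entry 2 2).measurable,
      show Measure.map (entry 2 2) haarSO3 = _ from map_entry_two_two, lintegral_smul_measure,
      smul_eq_mul]
  have e3 : ∫⁻ c in Set.Icc (-1 : ℝ) 1, H c = 4 * ∫⁻ ψ in Set.Ioo 0 (Real.pi / 2),
      ∫⁻ φ in Set.Ioo 0 (Real.pi / 2), ∫⁻ c in Set.Ioo (-1 : ℝ) 1, f (pq φ ψ c) := by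
    -- Reflecting either angle about `π/2` changes the sign of `c`, which the symmetric `c`-integral
    -- does not see. The two foldings give the factor `4`.
    have hneg (φ ψ : ℝ) : ∫⁻ c in Set.Ioo (-1 : ℝ) 1, f (pq φ ψ (-c)) =
        ∫⁻ c in Set.Ioo (-1 : ℝ) 1, f (pq φ ψ c) := by
      have := (Measure.measurePreserving_neg (volume : Measure ℝ)).setLIntegral_comp_preimage_emb
        (MeasurableEquiv.neg ℝ).measurableEmbedding (fun c => f (pq φ ψ c)) (Set.Ioo (-1) 1)
      simpa using this
    calc _ = ∫⁻ c in Set.Ioo (-1 : ℝ) 1, H c := setLIntegral_congr Ioo_ae_eq_Icc.symm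
      _ = ∫⁻ ψ in Set.Ioc 0 Real.pi, ∫⁻ c in Set.Ioo (-1 : ℝ) 1, ∫⁻ φ in Set.Ioc 0 Real.pi,
          f (pq φ ψ c) := by
          refine lintegral_lintegral_swap (Measurable.aemeasurable ?_)
          refine Measurable.lintegral_prod_right' (f := fun x : (ℝ × ℝ) × ℝ =>
            f (pq x.2 x.1.2 x.1.1)) ?_
          exact hm.comp (measurable_snd.prodMk
            ((measurable_snd.comp measurable_fst).prodMk (measurable_fst.comp measurable_fst)))
      _ = ∫⁻ ψ in Set.Ioc 0 Real.pi, ∫⁻ φ in Set.Ioc 0 Real.pi, ∫⁻ c in Set.Ioo (-1 : ℝ) 1,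
          f (pq φ ψ c) := by
          refine lintegral_congr fun ψ => lintegral_lintegral_swap ?_
          exact (hm.comp (measurable_snd.prodMk
            (measurable_const.prodMk measurable_fst))).aemeasurable
      _ = _ := by
          rw [setLIntegral_Ioc_of_reflect hpi
            (fun ψ => by simp only [pq_pi_sub_right, hneg])]
          have (ψ : ℝ) := setLIntegral_Ioc_of_reflect hpi
            (f := fun φ => ∫⁻ c in Set.Ioo (-1 : ℝ) 1, f (pq φ ψ c))
            (fun φ => by simp only [pq_pi_sub_left, hneg])
          simp only [this]
          rw [lintegral_const_mul' _ _ (by simp), ← mul_assoc]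
          norm_num
  rw [e2, e3, ← mul_assoc, ← mul_assoc] at e1
  have hpp : ENNReal.ofReal (1 / Real.pi ^ 2) * (ENNReal.ofReal Real.pi * ENNReal.ofReal Real.pi)
      = 1 := by
    rw [← ENNReal.ofReal_mul hpi.le, ← ENNReal.ofReal_mul (by positivity), ← sq,
      one_div_mul_cancel (by positivity), ENNReal.ofReal_one]
  have h24 : (2⁻¹ : ℝ≥0∞) * 4 = 2 := by
    rw [show (4 : ℝ≥0∞) = 2 * 2 by norm_num, ← mul_assoc,
      ENNReal.inv_mul_cancel (by norm_num) (by norm_num), one_mul]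
  rw [← one_mul (∫⁻ g, f (PQ g) ∂haarSO3), ← hpp, mul_assoc, e1, h24, ← mul_assoc,
    show 2 / Real.pi ^ 2 = 1 / Real.pi ^ 2 * 2 by ring, ENNReal.ofReal_mul (by positivity),
    ENNReal.ofReal_ofNat]

/-! ### The area formula with multiplicities. -/

theorem exists_open_injOn {E : Type*} [NormedAddCommGroup E] [NormedSpace ℝ E] [FiniteDimensional ℝ E]
    {f : E → E} {f' : E →L[ℝ] E} {x : E} (hf : HasStrictFDerivAt f f' x)
    (hdet : f'.det ≠ 0) : ∃ u : Set E, IsOpen u ∧ x ∈ u ∧ Set.InjOn f u := by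
  have := FiniteDimensional.complete ℝ E
  have hf2 : HasStrictFDerivAt f (f'.toContinuousLinearEquivOfDetNeZero hdet : E →L[ℝ] E) x := by
    simpa using hf
  refine ⟨(hf2.toOpenPartialHomeomorph f).source, (hf2.toOpenPartialHomeomorph f).open_source,
    hf2.mem_toOpenPartialHomeomorph_source, ?_⟩
  exact (hf2.toOpenPartialHomeomorph f).injOn

/-- The inverse function theorem gives local injectivity; a countable subcover, made disjoint, gives
the pieces. -/
theorem exists_partition_injOn {E : Type*} [NormedAddCommGroup E] [NormedSpace ℝ E] [FiniteDimensional ℝ E]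
    [MeasurableSpace E] [BorelSpace E] {f : E → E} {f' : E → E →L[ℝ] E} {s : Set E}
    (hs : MeasurableSet s) (hf : ∀ x ∈ s, HasStrictFDerivAt f (f' x) x)
    (hdet : ∀ x ∈ s, (f' x).det ≠ 0) :
    ∃ t : ℕ → Set E, (∀ n, MeasurableSet (t n)) ∧ Pairwise (Function.onFun Disjoint t) ∧
      ⋃ n, t n = s ∧ ∀ n, Set.InjOn f (t n) := by
  rcases s.eq_empty_or_nonempty with rfl | hne
  · exact ⟨fun _ => ∅, by simp, fun _ _ _ => by simp [Function.onFun], by simp, by simp⟩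
  have h (x : E) : ∃ u : Set E, IsOpen u ∧ (x ∈ s → x ∈ u) ∧ Set.InjOn f u := by
    by_cases hx : x ∈ s
    · obtain ⟨u, h1, h2, h3⟩ := exists_open_injOn (hf x hx) (hdet x hx)
      exact ⟨u, h1, fun _ => h2, h3⟩
    · exact ⟨∅, isOpen_empty, fun h => absurd h hx, by simp⟩
  choose u ho hmem hinj using h
  obtain ⟨T, -, hTc, hTs⟩ := TopologicalSpace.countable_cover_nhdsWithin (f := u) (s := s)
    fun x hx => mem_nhdsWithin_of_mem_nhds ((ho x).mem_nhds (hmem x hx))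
  have hTne : T.Nonempty := by
    obtain ⟨x, hx⟩ := hne
    obtain ⟨i, hi, -⟩ := Set.mem_iUnion₂.mp (hTs hx)
    exact ⟨i, hi⟩
  obtain ⟨e, rfl⟩ := hTc.exists_eq_range hTne
  refine ⟨fun n => disjointed (fun n => u (e n)) n ∩ s, fun n => ?_, fun i j hij => ?_, ?_,
    fun n => ?_⟩
  · exact (MeasurableSet.disjointed (fun n => (ho (e n)).measurableSet) n).inter hs
  · exact (disjoint_disjointed (fun n => u (e n)) hij).mono Set.inter_subset_left
      Set.inter_subset_left
  · rw [← Set.iUnion_inter, iUnion_disjointed]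
    refine Set.inter_eq_right.mpr (hTs.trans ?_)
    simp
  · exact (hinj (e n)).mono (Set.inter_subset_left.trans (disjointed_subset _ n))

/-- Each injective piece contributes at most one point of the fiber, and the extension is `0` off
its image. This reduces measurability and integration of fiber sums to single pieces. -/
theorem tsum_fiber_eq_tsum_extend {α β : Type*} {f : α → β} {s : Set α} {t : ℕ → Set α}
    (hd : Pairwise (Function.onFun Disjoint t)) (hu : ⋃ n, t n = s)
    (hinj : ∀ n, Set.InjOn f (t n)) (w : α → ℝ≥0∞) (y : β) :
    ∑' x : {x // x ∈ s ∧ f x = y}, w x =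
      ∑' n, Function.extend ((t n).domRestrict f) (fun x => w x) 0 y := by
  have h1 : ∑' x : {x // x ∈ s ∧ f x = y}, w x =
      ∑' n, ∑' x, (t n ∩ f ⁻¹' {y}).indicator w x := by
    rw [ENNReal.tsum_comm]
    refine (tsum_subtype {x | x ∈ s ∧ f x = y} w).trans (tsum_congr fun x => ?_)
    by_cases hx : x ∈ s ∧ f x = y
    · obtain ⟨n, hn⟩ := Set.mem_iUnion.mp (hu ▸ hx.1)
      rw [tsum_eq_single n, Set.indicator_of_mem (s := {x | x ∈ s ∧ f x = y}) hx,
        Set.indicator_of_mem (s := t n ∩ f ⁻¹' {y}) ⟨hn, hx.2⟩]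
      intro m hm
      exact Set.indicator_of_notMem (fun h => Set.disjoint_left.mp (hd hm) h.1 hn) _
    · rw [Set.indicator_of_notMem (s := {x | x ∈ s ∧ f x = y}) hx]
      refine (ENNReal.tsum_eq_zero.mpr fun n => Set.indicator_of_notMem (fun h => hx ?_) _).symm
      exact ⟨hu ▸ Set.mem_iUnion.mpr ⟨n, h.1⟩, h.2⟩
  rw [h1]
  refine tsum_congr fun n => ?_
  by_cases hy : ∃ x : t n, f x = y
  · obtain ⟨x, rfl⟩ := hy
    have hr : Function.Injective ((t n).domRestrict f) := (hinj n).injective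
    rw [show f x = (t n).domRestrict f x from rfl, hr.extend_apply, tsum_eq_single (x : α)]
    · exact Set.indicator_of_mem (s := t n ∩ f ⁻¹' {f x}) ⟨x.2, rfl⟩ _
    · intro z hz
      exact Set.indicator_of_notMem (fun h => hz (hinj n h.1 x.2 h.2)) _
  · rw [Function.extend_apply' (f := (t n).domRestrict f) _ _ _ hy]
    refine ENNReal.tsum_eq_zero.mpr fun x => Set.indicator_of_notMem (fun h => hy ?_) _
    exact ⟨⟨x, h.1⟩, h.2⟩

theorem measurable_tsum_fiber {E : Type*} [NormedAddCommGroup E] [NormedSpace ℝ E] [FiniteDimensional ℝ E]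
    [MeasurableSpace E] [BorelSpace E] {f : E → E} {f' : E → E →L[ℝ] E} {s : Set E}
    (hs : MeasurableSet s) (hf : ∀ x ∈ s, HasStrictFDerivAt f (f' x) x)
    (hdet : ∀ x ∈ s, (f' x).det ≠ 0) {w : E → ℝ≥0∞} (hw : Measurable w) :
    Measurable fun y => ∑' x : {x // x ∈ s ∧ f x = y}, w x := by
  obtain ⟨t, ht, hd, hu, hinj⟩ := exists_partition_injOn hs hf hdet
  rw [funext (tsum_fiber_eq_tsum_extend hd hu hinj w)]
  refine Measurable.tsum fun n => ?_
  have hsub : t n ⊆ s := hu ▸ Set.subset_iUnion t n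
  exact (measurableEmbedding_of_fderivWithin (ht n)
    (fun x hx => (hf x (hsub hx)).hasFDerivAt.hasFDerivWithinAt) (hinj n)).measurable_extend
    (hw.comp measurable_subtype_coe) measurable_zero

/-- The area formula for maps with nonvanishing Jacobian determinant. -/
theorem lintegral_mul_tsum_fiber {E : Type*} [NormedAddCommGroup E] [NormedSpace ℝ E] [FiniteDimensional ℝ E]
    [MeasurableSpace E] [BorelSpace E] (μ : Measure E) [μ.IsAddHaarMeasure]
    {f : E → E} {f' : E → E →L[ℝ] E} {s : Set E}
    (hs : MeasurableSet s) (hf : ∀ x ∈ s, HasStrictFDerivAt f (f' x) x)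
    (hdet : ∀ x ∈ s, (f' x).det ≠ 0) {w : E → ℝ≥0∞} (hw : Measurable w)
    {h : E → ℝ≥0∞} (hh : Measurable h) :
    ∫⁻ y, h y * ∑' x : {x // x ∈ s ∧ f x = y}, w x ∂μ =
      ∫⁻ x in s, ENNReal.ofReal |(f' x).det| * (h (f x) * w x) ∂μ := by
  obtain ⟨t, ht, hd, hu, hinj⟩ := exists_partition_injOn hs hf hdet
  have hsub (n : ℕ) : t n ⊆ s := hu ▸ Set.subset_iUnion t n
  have hder (n : ℕ) (x : E) (hx : x ∈ t n) : HasFDerivWithinAt f (f' x) (t n) x :=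
    (hf x (hsub n hx)).hasFDerivAt.hasFDerivWithinAt
  have hS (n : ℕ) : Measurable (Function.extend ((t n).domRestrict f) (fun x => w x) 0) :=
    (measurableEmbedding_of_fderivWithin (ht n) (hder n) (hinj n)).measurable_extend
      (hw.comp measurable_subtype_coe) measurable_zero
  simp only [tsum_fiber_eq_tsum_extend hd hu hinj w, ← ENNReal.tsum_mul_left]
  rw [lintegral_tsum (f := fun n y => h y * Function.extend ((t n).domRestrict f)
    (fun x => w x) 0 y) fun n => (hh.mul (hS n)).aemeasurable, ← hu, lintegral_iUnion ht hd]
  refine tsum_congr fun n => ?_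
  have hr : Function.Injective ((t n).domRestrict f) := (hinj n).injective
  calc _ = ∫⁻ y in f '' t n, h y * Function.extend ((t n).domRestrict f) (fun x => w x) 0 y ∂μ := by
        refine (setLIntegral_eq_of_support_subset ?_).symm
        intro y hy
        by_contra hy'
        apply hy
        have : ¬ ∃ x, (t n).domRestrict f x = y := by
          rintro ⟨x, rfl⟩
          exact hy' ⟨x, x.2, rfl⟩
        simp only [Function.extend_apply' _ _ _ this, Pi.zero_apply, mul_zero]
    _ = _ := by
        rw [lintegral_image_eq_lintegral_abs_det_fderiv_mul μ (ht n) (hder n) (hinj n)]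
        refine setLIntegral_congr_fun (ht n) fun x hx => ?_
        have : Function.extend ((t n).domRestrict f) (fun x => w x) 0 (f x) = w x :=
          hr.extend_apply (fun x : t n => w x) 0 ⟨x, hx⟩
        simp only [this]

/-! ### The map `(ψ, φ, c) ↦ (ψ, P, Q)`, its critical set and its fiber sums. -/

instance : (volume : Measure (ℝ × ℝ)).IsAddHaarMeasure :=
  Measure.prod.instIsAddHaarMeasure volume volume

instance : (volume : Measure (ℝ × ℝ × ℝ)).IsAddHaarMeasure :=
  Measure.prod.instIsAddHaarMeasure volume volume

theorem det_of_apply {L : ℝ × ℝ × ℝ →L[ℝ] ℝ × ℝ × ℝ} {a b p₁ q₁ p₂ q₂ : ℝ}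
    (h0 : L (1, 0, 0) = (1, a, b)) (h1 : L (0, 1, 0) = (0, p₁, q₁))
    (h2 : L (0, 0, 1) = (0, p₂, q₂)) : L.det = p₁ * q₂ - p₂ * q₁ := by
  let e : (ℝ × ℝ × ℝ) ≃ₗ[ℝ] (Fin 3 → ℝ) :=
    { toFun := fun x => ![x.1, x.2.1, x.2.2]
      invFun := fun v => (v 0, v 1, v 2)
      map_add' := fun x y => by ext i; fin_cases i <;> simp
      map_smul' := fun r x => by ext i; fin_cases i <;> simp
      left_inv := fun x => by simp
      right_inv := fun v => by ext i; fin_cases i <;> simp }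
  rw [ContinuousLinearMap.det, ← LinearMap.det_toMatrix (Module.Basis.ofEquivFun e)]
  have hb0 : Module.Basis.ofEquivFun e 0 = (1, 0, 0) := by
    simp [e, Module.Basis.coe_ofEquivFun]
  have hb1 : Module.Basis.ofEquivFun e 1 = (0, 1, 0) := by
    simp [e, Module.Basis.coe_ofEquivFun]
  have hb2 : Module.Basis.ofEquivFun e 2 = (0, 0, 1) := by
    simp [e, Module.Basis.coe_ofEquivFun]
  rw [Matrix.det_fin_three]
  simp only [LinearMap.toMatrix_apply, hb0, hb1, hb2, ContinuousLinearMap.coe_coe, h0, h1, h2]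
  simp [e]

/-- The map `(ψ, φ, c) ↦ (ψ, P, Q)`. -/
noncomputable def angleMap (x : ℝ × ℝ × ℝ) : ℝ × ℝ × ℝ := (x.1, pq x.2.1 x.1 x.2.2)

theorem contDiff_angleMap : ContDiff ℝ 1 angleMap := by
  unfold angleMap pq
  simp only [pFun_eq, qFun_eq]
  fun_prop

theorem hasDerivAt_pFun_left (φ ψ c : ℝ) :
    HasDerivAt (fun φ => pFun φ ψ c) (pFunφ φ ψ c) φ := by
  have hc := Real.hasDerivAt_cos φ
  have hs := Real.hasDerivAt_sin φ
  have h := (((hc.pow 2).const_add 1).mul_const (1 + Real.cos ψ ^ 2)).neg.mul_const (c ^ 2)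
    |>.add ((((hc.const_mul 2).mul_const (Real.cos ψ)).mul hs).mul_const (Real.sin ψ)
      |>.mul_const c) |>.sub
    (((((hc.pow 2).mul_const (Real.cos ψ ^ 2)).sub ((hc.pow 2).const_mul 2)).sub_const
      (2 * Real.cos ψ ^ 2)).add_const 3)
  refine (h.congr_of_eventuallyEq
    (Filter.Eventually.of_forall fun φ => by simp [pFun_eq])).congr_deriv ?_
  have := Real.sin_sq φ
  simp [pFunφ]
  linear_combination (-2 * Real.cos ψ * Real.sin ψ * c) * this

theorem hasDerivAt_qFun_left (φ ψ c : ℝ) :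
    HasDerivAt (fun φ => qFun φ ψ c) (qFunφ φ ψ c) φ := by
  have hc := Real.hasDerivAt_cos φ
  have hs := Real.hasDerivAt_sin φ
  have h := ((((hc.pow 2).mul_const (Real.cos ψ ^ 2)).const_sub 1).const_mul 2).mul_const (c ^ 2)
    |>.add ((((hc.const_mul 4).mul_const (Real.cos ψ)).mul hs).mul_const (Real.sin ψ)
      |>.mul_const c) |>.sub
    ((((hc.pow 2).const_sub 1).const_mul 2).mul_const (1 - Real.cos ψ ^ 2))
  refine (h.congr_of_eventuallyEq
    (Filter.Eventually.of_forall fun φ => by simp [qFun_eq])).congr_deriv ?_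
  have := Real.sin_sq φ
  simp [qFunφ]
  linear_combination (-4 * Real.cos ψ * Real.sin ψ * c) * this

theorem hasDerivAt_pFun_right (φ ψ c : ℝ) : HasDerivAt (pFun φ ψ) (pFunc φ ψ c) c := by
  refine ((polyP 0 φ ψ).hasDerivAt c).congr_deriv ?_
  simp [polyP, pFunc, derivative_pow]
  ring

theorem hasDerivAt_qFun_right (φ ψ c : ℝ) : HasDerivAt (qFun φ ψ) (qFunc φ ψ c) c := by
  refine ((polyQ 0 φ ψ).hasDerivAt c).congr_deriv ?_
  simp [polyQ, qFunc, derivative_pow]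
  ring

theorem det_fderiv_angleMap (x : ℝ × ℝ × ℝ) :
    (fderiv ℝ angleMap x).det = jac x.2.1 x.1 x.2.2 := by
  obtain ⟨ψ, φ, c⟩ := x
  have hd : HasFDerivAt angleMap (fderiv ℝ angleMap (ψ, φ, c)) (ψ, φ, c) :=
    (contDiff_angleMap.differentiable one_ne_zero _).hasFDerivAt
  set L := fderiv ℝ angleMap (ψ, φ, c)
  have h0 : (L (1, 0, 0)).1 = 1 := by
    have h1 : HasFDerivAt (fun x => (angleMap x).1)
        ((ContinuousLinearMap.fst ℝ ℝ (ℝ × ℝ)).comp L) (ψ, φ, c) := hd.fst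
    have h2 := h1.unique (hasFDerivAt_fst (p := (ψ, φ, c)))
    simpa using congrArg (fun A => A (1, 0, 0)) h2
  have h1 : L (0, 1, 0) = (0, pFunφ φ ψ c, qFunφ φ ψ c) := by
    have e1 : HasDerivAt (fun t : ℝ => ((ψ, t, c) : ℝ × ℝ × ℝ)) (0, 1, 0) φ :=
      (hasDerivAt_const φ ψ).prodMk ((hasDerivAt_id φ).prodMk (hasDerivAt_const φ c))
    have e2 := hd.comp_hasDerivAt φ e1
    exact e2.unique ((hasDerivAt_const φ ψ).prodMk
      ((hasDerivAt_pFun_left φ ψ c).prodMk (hasDerivAt_qFun_left φ ψ c)))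
  have h2 : L (0, 0, 1) = (0, pFunc φ ψ c, qFunc φ ψ c) := by
    have e1 : HasDerivAt (fun t : ℝ => ((ψ, φ, t) : ℝ × ℝ × ℝ)) (0, 0, 1) c :=
      (hasDerivAt_const c ψ).prodMk ((hasDerivAt_const c φ).prodMk (hasDerivAt_id c))
    have e2 := hd.comp_hasDerivAt c e1
    exact e2.unique ((hasDerivAt_const c ψ).prodMk
      ((hasDerivAt_pFun_right φ ψ c).prodMk (hasDerivAt_qFun_right φ ψ c)))
  rw [det_of_apply (a := (L (1, 0, 0)).2.1) (b := (L (1, 0, 0)).2.2) (Prod.ext h0 rfl) h1 h2,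
    jac]

theorem volume_cubic_eq_zero {a₃ a₂ : ℝ} (a₁ a₀ : ℝ) (h : a₃ ≠ 0 ∨ a₂ ≠ 0) :
    volume {c : ℝ | a₃ * c ^ 3 + a₂ * c ^ 2 + a₁ * c + a₀ = 0} = 0 := by
  set f : ℝ[X] := C a₃ * X ^ 3 + C a₂ * X ^ 2 + C a₁ * X + C a₀ with hf
  have hf0 : f ≠ 0 := by
    intro h0
    rcases h with h | h
    · exact h (by simpa [hf, coeff_X, coeff_C] using congrArg (fun g => coeff g 3) h0)
    · exact h (by simpa [hf, coeff_X, coeff_C] using congrArg (fun g => coeff g 2) h0)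
  refine Set.Finite.measure_zero ((f.roots.toFinset.finite_toSet).subset fun c hc => ?_) _
  simpa [hf0] using show f.eval c = 0 by simpa [hf] using hc

theorem continuous_jac : Continuous fun x : ℝ × ℝ × ℝ => jac x.2.1 x.1 x.2.2 := by
  simp only [jac, pFunφ, pFunc, qFunφ, qFunc]
  fun_prop

/-- The domain of the angles `(ψ, φ)` and of `c = cos θ`. -/
def angleDomain : Set (ℝ × ℝ × ℝ) :=
  Set.Ioo 0 (Real.pi / 2) ×ˢ Set.Ioo 0 (Real.pi / 2) ×ˢ Set.Ioo (-1 : ℝ) 1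

/-- The critical points of `angleMap`. -/
def angleCrit : Set (ℝ × ℝ × ℝ) := angleDomain ∩ {x | jac x.2.1 x.1 x.2.2 = 0}

theorem measurableSet_angleDomain : MeasurableSet angleDomain :=
  measurableSet_Ioo.prod (measurableSet_Ioo.prod measurableSet_Ioo)

theorem measurableSet_angleCrit : MeasurableSet angleCrit :=
  measurableSet_angleDomain.inter (isClosed_eq continuous_jac continuous_const).measurableSet

theorem sin_pos_of_mem_Ioo {t : ℝ} (h : t ∈ Set.Ioo 0 (Real.pi / 2)) : 0 < Real.sin t :=
  Real.sin_pos_of_pos_of_lt_pi h.1 (by linarith [h.2, Real.pi_pos])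

theorem cos_pos_of_mem_Ioo {t : ℝ} (h : t ∈ Set.Ioo 0 (Real.pi / 2)) : 0 < Real.cos t :=
  Real.cos_pos_of_mem_Ioo ⟨by linarith [h.1, Real.pi_pos], h.2⟩

theorem volume_angleCrit : volume angleCrit = 0 := by
  rw [Measure.volume_eq_prod, Measure.measure_prod_null measurableSet_angleCrit]
  refine Filter.Eventually.of_forall fun ψ => ?_
  have hm := measurable_prodMk_left (x := ψ) measurableSet_angleCrit
  rw [Measure.volume_eq_prod, Pi.zero_apply, Measure.measure_prod_null hm]
  refine Filter.Eventually.of_forall fun φ => ?_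
  by_cases hφ : φ ∈ Set.Ioo 0 (Real.pi / 2)
  · have hx := cos_pos_of_mem_Ioo hφ
    have hs := sin_pos_of_mem_Ioo hφ
    -- For fixed angles `jac` is a cubic in `c`, and this is its leading coefficient.
    have ha : 8 * Real.cos φ * Real.sin φ * (1 + Real.cos ψ ^ 2) ^ 2 ≠ 0 := by positivity
    refine measure_mono_null (fun c hc => ?_) (volume_cubic_eq_zero
      (a₂ := 2 * (2 * Real.cos φ ^ 2 - 1) * Real.cos ψ * Real.sin ψ
          * (4 * (1 - Real.cos φ ^ 2 * Real.cos ψ ^ 2))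
        + 2 * (1 + Real.cos φ ^ 2) * (1 + Real.cos ψ ^ 2)
          * (4 * (2 * Real.cos φ ^ 2 - 1) * Real.cos ψ * Real.sin ψ)
        + 2 * Real.cos φ * Real.sin φ * (1 + Real.cos ψ ^ 2)
          * (4 * Real.cos φ * Real.cos ψ * Real.sin φ * Real.sin ψ)
        - 2 * Real.cos φ * Real.cos ψ * Real.sin φ * Real.sin ψ
          * (4 * Real.cos φ * Real.sin φ * Real.cos ψ ^ 2))
      (2 * (2 * Real.cos φ ^ 2 - 1) * Real.cos ψ * Real.sin ψ
          * (4 * Real.cos φ * Real.cos ψ * Real.sin φ * Real.sin ψ)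
        + 2 * Real.cos φ * Real.sin φ * (Real.cos ψ ^ 2 - 2)
          * (4 * (1 - Real.cos φ ^ 2 * Real.cos ψ ^ 2))
        + 2 * (1 + Real.cos φ ^ 2) * (1 + Real.cos ψ ^ 2)
          * (4 * Real.cos φ * Real.sin φ * (Real.cos ψ ^ 2 - 1))
        - 2 * Real.cos φ * Real.cos ψ * Real.sin φ * Real.sin ψ
          * (4 * (2 * Real.cos φ ^ 2 - 1) * Real.cos ψ * Real.sin ψ))
      (2 * Real.cos φ * Real.sin φ * (Real.cos ψ ^ 2 - 2)
          * (4 * Real.cos φ * Real.cos ψ * Real.sin φ * Real.sin ψ)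
        - 2 * Real.cos φ * Real.cos ψ * Real.sin φ * Real.sin ψ
          * (4 * Real.cos φ * Real.sin φ * (Real.cos ψ ^ 2 - 1)))
      (Or.inl ha))
    have hc' : jac φ ψ c = 0 := hc.2
    simp only [jac, pFunφ, pFunc, qFunφ, qFunc] at hc'
    simp only [Set.mem_ofPred_eq]
    linear_combination hc'
  · refine measure_mono_null (fun c hc => absurd hc.1.2.1 hφ) (measure_empty (μ := volume))

/-- The Sard-type case of equal dimensions. Almost every fiber then avoids critical points, so
discarding them in `fiberSum` loses no root of `R`. -/
theorem volume_image_angleCrit : volume (angleMap '' angleCrit) = 0 := by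
  refine addHaar_image_eq_zero_of_det_fderivWithin_eq_zero volume (f' := fderiv ℝ angleMap)
    (fun x _ => (contDiff_angleMap.differentiable one_ne_zero x).hasFDerivAt.hasFDerivWithinAt)
    fun x hx => ?_
  rw [det_fderiv_angleMap]
  exact hx.2

/-- The sum of the inverse Jacobians over the fibers of `angleMap`. -/
noncomputable def fiberSum (y : ℝ × ℝ × ℝ) : ℝ≥0∞ :=
  ∑' x : {x : ℝ × ℝ × ℝ // x ∈ angleDomain \ angleCrit ∧ angleMap x = y},
    (ENNReal.ofReal |jac x.1.2.1 x.1.1 x.1.2.2|)⁻¹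

theorem jac_ne_zero {x : ℝ × ℝ × ℝ} (hx : x ∈ angleDomain \ angleCrit) :
    jac x.2.1 x.1 x.2.2 ≠ 0 := fun h => hx.2 ⟨hx.1, h⟩

theorem hasStrictFDerivAt_angleMap (x : ℝ × ℝ × ℝ) :
    HasStrictFDerivAt angleMap (fderiv ℝ angleMap x) x :=
  contDiff_angleMap.contDiffAt.hasStrictFDerivAt one_ne_zero

theorem measurable_inv_jac :
    Measurable fun x : ℝ × ℝ × ℝ => (ENNReal.ofReal |jac x.2.1 x.1 x.2.2|)⁻¹ :=
  continuous_jac.measurable.abs.ennreal_ofReal.inv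

theorem measurable_fiberSum : Measurable fiberSum :=
  measurable_tsum_fiber (measurableSet_angleDomain.diff measurableSet_angleCrit)
    (fun x _ => hasStrictFDerivAt_angleMap x)
    (fun x hx => (det_fderiv_angleMap x).trans_ne (jac_ne_zero hx)) measurable_inv_jac

theorem lintegral_mul_fiberSum {h : ℝ × ℝ × ℝ → ℝ≥0∞} (hh : Measurable h) :
    ∫⁻ y, h y * fiberSum y = ∫⁻ x in angleDomain, h (angleMap x) := by
  have hm := measurableSet_angleDomain.diff measurableSet_angleCrit
  have key := lintegral_mul_tsum_fiber volume hm
    (fun x _ => hasStrictFDerivAt_angleMap x)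
    (fun x hx => (det_fderiv_angleMap x).trans_ne (jac_ne_zero hx)) measurable_inv_jac hh
  refine key.trans ?_
  calc _ = ∫⁻ x in angleDomain \ angleCrit, h (angleMap x) := by
        refine setLIntegral_congr_fun hm fun x hx => ?_
        have h0 : ENNReal.ofReal |jac x.2.1 x.1 x.2.2| ≠ 0 := by
          simpa using jac_ne_zero hx
        simp only [det_fderiv_angleMap]
        rw [mul_left_comm, ENNReal.mul_inv_cancel h0 ENNReal.ofReal_ne_top, mul_one]
    _ = _ := setLIntegral_congr (sdiff_null_ae_eq_self volume_angleCrit)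

/-! ### Fibers of `angleMap` and roots of `R`. -/

theorem resR_pFun_qFun (φ ψ c : ℝ) :
    resR (Real.cos φ ^ 2) (Real.cos ψ ^ 2) (pFun φ ψ c) (qFun φ ψ c) = 0 := by
  have h1 := Real.sin_sq φ
  have h2 := Real.sin_sq ψ
  rw [resR_eq, pFun_eq, qFun_eq]
  generalize Real.cos φ = x at *
  generalize Real.sin φ = s at *
  generalize Real.cos ψ = y at *
  generalize Real.sin ψ = t at *
  have hβ : (2 * x * y * s * t) ^ 2 = 4 * x ^ 2 * (1 - x ^ 2) * (y ^ 2 * (1 - y ^ 2)) := by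
    rw [← h1, ← h2]
    ring
  linear_combination 4 * c ^ 2 * (2 + x ^ 2 + y ^ 2) ^ 2 * hβ

/-- `P - Q/2` determines `c²`; then `Q` determines `c`, as its linear coefficient is positive on
open quarter-period angles. -/
theorem pq_injOn {φ φ' ψ c c' : ℝ} (hψ : ψ ∈ Set.Ioo 0 (Real.pi / 2))
    (hφ : φ ∈ Set.Ioo 0 (Real.pi / 2)) (hφ' : φ' ∈ Set.Ioo 0 (Real.pi / 2))
    (h : pq φ ψ c = pq φ' ψ c') (hu : Real.cos φ ^ 2 = Real.cos φ' ^ 2) : φ = φ' ∧ c = c' := by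
  have hx := cos_pos_of_mem_Ioo hφ
  have hx' := cos_pos_of_mem_Ioo hφ'
  have hpi := Real.pi_pos
  have hφφ : φ = φ' := Real.injOn_cos ⟨hφ.1.le, by linarith [hφ.2]⟩
    ⟨hφ'.1.le, by linarith [hφ'.2]⟩ ((sq_eq_sq₀ hx.le hx'.le).mp hu)
  subst hφφ
  refine ⟨rfl, ?_⟩
  have hs := sin_pos_of_mem_Ioo hφ
  have hy := cos_pos_of_mem_Ioo hψ
  have ht := sin_pos_of_mem_Ioo hψ
  have hp : pFun φ ψ c = pFun φ ψ c' := congrArg Prod.fst h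
  have hq : qFun φ ψ c = qFun φ ψ c' := congrArg Prod.snd h
  rw [pFun_eq, pFun_eq] at hp
  rw [qFun_eq, qFun_eq] at hq
  have hD : 0 < 2 + Real.cos φ ^ 2 + Real.cos ψ ^ 2 := by positivity
  have hcc : c ^ 2 = c' ^ 2 := by
    apply mul_left_cancel₀ hD.ne'
    linear_combination -hp + hq / 2
  rw [hcc] at hq
  have hβ : 0 < 4 * Real.cos φ * Real.cos ψ * Real.sin φ * Real.sin ψ := by positivity
  apply mul_left_cancel₀ hβ.ne'
  linear_combination hq

/-- Away from exceptional points every root of `R` comes from a point of the angle domain. -/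
theorem exists_pq_eq_of_resR_eq_zero {ψ p q u : ℝ} (hψ : ψ ∈ Set.Ioo 0 (Real.pi / 2))
    (hq : q < 0) (hu : u ∈ Set.Icc (0 : ℝ) 1) (hR : resR u (Real.cos ψ ^ 2) p q = 0)
    (h0 : resR 0 (Real.cos ψ ^ 2) p q ≠ 0) (h1 : resR 1 (Real.cos ψ ^ 2) p q ≠ 0)
    (hp : p ≠ (1 + q / (2 * (1 - Real.cos ψ ^ 2))) + Real.cos ψ ^ 2 - 2 + q / 2) :
    ∃ φ ∈ Set.Ioo 0 (Real.pi / 2), ∃ c ∈ Set.Ioo (-1 : ℝ) 1,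
      pq φ ψ c = (p, q) ∧ Real.cos φ ^ 2 = u := by
  have hy := cos_pos_of_mem_Ioo hψ
  have ht := sin_pos_of_mem_Ioo hψ
  have hu0 : 0 < u := lt_of_le_of_ne hu.1 fun h => h0 (h ▸ hR)
  have hu1 : u < 1 := lt_of_le_of_ne hu.2 fun h => h1 (h ▸ hR)
  have hsq : Real.sqrt u ^ 2 = u := Real.sq_sqrt hu.1
  have hs0 : 0 < Real.sqrt u := Real.sqrt_pos.mpr hu0
  have hs1 : Real.sqrt u < 1 := by
    rw [Real.sqrt_lt' one_pos]
    simpa using hu1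
  obtain ⟨φ, hφ, hx⟩ : ∃ φ ∈ Set.Ioo 0 (Real.pi / 2), Real.cos φ ^ 2 = u :=
    ⟨Real.arccos (Real.sqrt u), ⟨Real.arccos_pos.mpr hs1, Real.arccos_lt_pi_div_two.mpr hs0⟩, by
      rw [Real.cos_arccos (by linarith) hs1.le, hsq]⟩
  have hcx := cos_pos_of_mem_Ioo hφ
  have hsx := sin_pos_of_mem_Ioo hφ
  have e1 := Real.sin_sq φ
  have e2 := Real.sin_sq ψ
  have hb : 0 < Real.cos φ * Real.cos ψ * Real.sin φ * Real.sin ψ := by positivity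
  have hb2 : (Real.cos φ * Real.cos ψ * Real.sin φ * Real.sin ψ) ^ 2 =
      u * (1 - u) * (Real.cos ψ ^ 2 * (1 - Real.cos ψ ^ 2)) := by
    rw [← e2, mul_pow, mul_pow, mul_pow, e1, hx]
    ring
  set b := Real.cos φ * Real.cos ψ * Real.sin φ * Real.sin ψ with hbdef
  set z := Real.cos ψ ^ 2 with hz
  have hz1 : 0 < 1 - z := by
    rw [← e2]
    positivity
  have hz0 : 0 < z := by positivity
  have hD : 0 < 2 + u + z := by positivity
  rw [resR_eq] at hR
  set N := u + z - 2 - p + q / 2 with hN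
  set A := (q / 2 + (1 - u) * (1 - z)) * (2 + u + z) - N * (1 - u * z) with hA
  have hA2 : A ^ 2 = 4 * b ^ 2 * N * (2 + u + z) := by
    rw [hb2]
    linear_combination hR / 4
  -- If `N ≤ 0`, then `A² ≤ 0` forces `A = N = 0`, so `u = 1 + q / (2(1-z))` and `p` takes exactly
  -- the value excluded by `hp`.
  have hNpos : 0 < N := by
    by_contra! hN0
    have hA0 : A = 0 := by
      have : 4 * b ^ 2 * N * (2 + u + z) ≤ 0 :=
        mul_nonpos_of_nonpos_of_nonneg
          (mul_nonpos_of_nonneg_of_nonpos (by positivity) hN0) hD.le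
      exact pow_eq_zero_iff two_ne_zero |>.mp (le_antisymm (hA2 ▸ this) (sq_nonneg A))
    have hN00 : N = 0 := by
      rw [hA0] at hA2
      have hne : 4 * b ^ 2 * (2 + u + z) ≠ 0 := by positivity
      apply mul_left_cancel₀ hne
      linear_combination -hA2
    rw [hA, hN00] at hA0
    have hk : q / 2 + (1 - u) * (1 - z) = 0 := by
      apply mul_right_cancel₀ hD.ne'
      linear_combination hA0
    apply hp
    have hu' : u = 1 + q / (2 * (1 - z)) := by
      field_simp
      linear_combination -2 * hk
    rw [← hu']
    linear_combination -hN00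
  -- The only candidate, from `2b(2+u+z)c = A`; the equation `R = 0` then supplies `(2+u+z)c² = N`.
  set c := A / (2 * b * (2 + u + z)) with hc
  have hbc : 2 * b * c = A / (2 + u + z) := by
    rw [hc]
    field_simp
  have hcc : c ^ 2 = N / (2 + u + z) := by
    rw [hc, div_pow, hA2]
    field_simp
    ring
  have hqF : qFun φ ψ c = q := by
    have : qFun φ ψ c = 2 * (1 - u * z) * c ^ 2 + 2 * (2 * b * c) - 2 * (1 - u) * (1 - z) := by
      rw [qFun_eq, hx]
      ring
    rw [this, hbc, hcc, hA]
    field_simp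
    ring
  have hpF : pFun φ ψ c = p := by
    have : pFun φ ψ c = -((1 + u) * (1 + z)) * c ^ 2 + 2 * b * c
        - (u * z - 2 * u - 2 * z + 3) := by
      rw [pFun_eq, hx]
      ring
    rw [this, hbc, hcc, hA]
    field_simp
    rw [hN]
    ring
  refine ⟨φ, hφ, c, ?_, by rw [pq, hpF, hqF], hx⟩
  rw [Set.mem_Ioo, ← abs_lt]
  by_contra! hc1
  -- `|c| ≥ 1` would give `q ≥ 0`.
  have h2 := le_qFun_of_one_le_abs φ ψ hc1
  rw [hqF, hx] at h2
  have : 0 ≤ 2 * (1 - u * z) * (|c| - 1) ^ 2 := by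
    have : 0 ≤ 1 - u * z := by
      have := mul_le_one₀ hu1.le hz0.le (sub_pos.mp hz1).le
      linarith
    positivity
  linarith

/-- The map `(ψ, φ, c) ↦ cos² φ` is a bijection from the fiber to the roots of `R` in `[0, 1]`, and
the derivative identity matches the summands. -/
theorem fiberSum_eq {ψ p q : ℝ} (hψ : ψ ∈ Set.Ioo 0 (Real.pi / 2)) (hq : q < 0)
    (h0 : resR 0 (Real.cos ψ ^ 2) p q ≠ 0) (h1 : resR 1 (Real.cos ψ ^ 2) p q ≠ 0)
    (hp : p ≠ (1 + q / (2 * (1 - Real.cos ψ ^ 2))) + Real.cos ψ ^ 2 - 2 + q / 2)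
    (hcrit : (ψ, p, q) ∉ angleMap '' angleCrit) :
    fiberSum (ψ, p, q) =
      ENNReal.ofReal (2 * Real.cos ψ * Real.sin ψ) * rootSum (Real.cos ψ ^ 2) p q := by
  have hy := cos_pos_of_mem_Ioo hψ
  have ht := sin_pos_of_mem_Ioo hψ
  let e : {x : ℝ × ℝ × ℝ // x ∈ angleDomain \ angleCrit ∧ angleMap x = (ψ, p, q)} →
      {u : ℝ // u ∈ Set.Icc (0 : ℝ) 1 ∧ (polyR (Real.cos ψ ^ 2) p q).IsRoot u} := fun x =>
    ⟨Real.cos x.1.2.1 ^ 2, ⟨sq_nonneg _, Real.cos_sq_le_one _⟩, by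
      obtain ⟨⟨ψ', φ, c⟩, hx, hx'⟩ := x
      simp only [angleMap, pq, Prod.mk.injEq] at hx'
      obtain ⟨rfl, rfl, rfl⟩ := hx'
      rw [IsRoot.def, eval_polyR]
      exact resR_pFun_qFun _ _ _⟩
  have he : Function.Bijective e := by
    constructor
    · rintro ⟨⟨ψ₁, φ₁, c₁⟩, h₁, k₁⟩ ⟨⟨ψ₂, φ₂, c₂⟩, h₂, k₂⟩ h
      obtain ⟨rfl, l₁⟩ := Prod.mk.inj k₁
      obtain ⟨l₀, l₂⟩ := Prod.mk.inj k₂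
      obtain rfl : ψ₂ = ψ₁ := l₀
      obtain ⟨hφ, hc⟩ := pq_injOn hψ h₁.1.2.1 h₂.1.2.1 (l₁.trans l₂.symm)
        (congrArg Subtype.val h)
      exact Subtype.ext (Prod.ext rfl (Prod.ext hφ hc))
    · rintro ⟨u, hu, hR⟩
      rw [IsRoot.def, eval_polyR] at hR
      obtain ⟨φ, hφ, c, hc, hpq, hcu⟩ := exists_pq_eq_of_resR_eq_zero hψ hq hu hR h0 h1 hp
      have hm : angleMap (ψ, φ, c) = (ψ, p, q) := by simp only [angleMap, hpq]
      refine ⟨⟨(ψ, φ, c), ⟨⟨hψ, hφ, hc⟩, fun h => hcrit ⟨_, h, hm⟩⟩, hm⟩, ?_⟩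
      exact Subtype.ext hcu
  rw [rootSum, fiberSum, ← ENNReal.tsum_mul_left, ← (Equiv.ofBijective e he).tsum_eq]
  refine tsum_congr fun x => ?_
  obtain ⟨⟨ψ', φ, c⟩, hx, hx'⟩ := x
  have hJ := jac_ne_zero hx
  simp only [angleMap, pq, Prod.mk.injEq] at hx'
  obtain ⟨rfl, rfl, rfl⟩ := hx'
  simp only [Equiv.ofBijective_apply, e, eval_derivative_polyR_eq_jac]
  simp only at hJ
  have hw : 0 < 2 * Real.cos ψ' * Real.sin ψ' := by positivity
  have hD : 0 < 2 + Real.cos φ ^ 2 + Real.cos ψ' ^ 2 := by positivity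
  have hJ' : 0 < |jac φ ψ' c| := abs_pos.mpr hJ
  rw [abs_mul, abs_mul, abs_of_pos hw, abs_of_pos hD,
    ← ENNReal.ofReal_div_of_pos (by positivity), ← ENNReal.ofReal_mul hw.le,
    ← ENNReal.ofReal_inv_of_pos hJ']
  congr 1
  field_simp

/-- Null sets of `ℝ³` detected on the lines parallel to the second axis. -/
theorem volume_eq_zero_of_forall_line {s : Set (ℝ × ℝ × ℝ)} (hs : MeasurableSet s)
    (h : ∀ a b : ℝ, volume {p : ℝ | (a, p, b) ∈ s} = 0) : volume s = 0 := by
  rw [Measure.volume_eq_prod, Measure.measure_prod_null hs]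
  refine Filter.Eventually.of_forall fun a => ?_
  have hm := measurable_prodMk_left (x := a) hs
  rw [Pi.zero_apply]
  refine (Measure.prod_apply_symm hm).trans ?_
  exact (lintegral_congr fun b => h a b).trans lintegral_zero

theorem cos_sq_lt_one {ψ : ℝ} (hψ : ψ ∈ Set.Ioo 0 (Real.pi / 2)) : Real.cos ψ ^ 2 < 1 := by
  have := sin_pos_of_mem_Ioo hψ
  have h : 0 < Real.sin ψ ^ 2 := by positivity
  rw [Real.sin_sq] at h
  linarith

theorem measurableSet_resR_eq_zero (u : ℝ) : MeasurableSet {y : ℝ × ℝ × ℝ |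
    y.1 ∈ Set.Ioo 0 (Real.pi / 2) ∧ resR u (Real.cos y.1 ^ 2) y.2.1 y.2.2 = 0} := by
  refine (measurable_fst measurableSet_Ioo).inter (isClosed_eq ?_ continuous_const).measurableSet
  simp only [resR]
  fun_prop

/-- For fixed `ψ` and `q`, `R` is quadratic in `p` with leading coefficient `4(1-uz)² ≠ 0`. Applied
at `u = 0` and `u = 1`, where `b = 0`. -/
theorem ae_resR_ne_zero {u : ℝ} (hu : u ∈ Set.Icc (0 : ℝ) 1) : ∀ᵐ y : ℝ × ℝ × ℝ,
    y.1 ∈ Set.Ioo 0 (Real.pi / 2) → resR u (Real.cos y.1 ^ 2) y.2.1 y.2.2 ≠ 0 := by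
  have : volume {y : ℝ × ℝ × ℝ |
      y.1 ∈ Set.Ioo 0 (Real.pi / 2) ∧ resR u (Real.cos y.1 ^ 2) y.2.1 y.2.2 = 0} = 0 := by
    refine volume_eq_zero_of_forall_line (measurableSet_resR_eq_zero u) fun ψ q => ?_
    by_cases hψ : ψ ∈ Set.Ioo 0 (Real.pi / 2)
    · set z := Real.cos ψ ^ 2 with hz
      have hz1 : 1 - u * z ≠ 0 := by
        have h1 := cos_sq_lt_one hψ
        have h2 : 0 ≤ z := by positivity
        have : u * z < 1 := by nlinarith [hu.1, hu.2]
        exact (sub_pos.mpr this).ne'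
      refine measure_mono_null (fun p hp => ?_) (volume_cubic_eq_zero (a₃ := 0)
        (a₂ := 4 * (1 - u * z) ^ 2)
        (4 * q * (1 + u) * (1 + z) * (1 - u * z) - 8 * (-4 + 2 * (u + z) + (u + z) ^ 2
          - 2 * u * z * (u + z) + u * z * (u - z) ^ 2)) (resR u z 0 q)
        (Or.inr (by positivity)))
      have hp' : resR u z p q = 0 := hp.2
      simp only [resR, Set.mem_ofPred_eq] at hp' ⊢
      linear_combination hp'
    · exact measure_mono_null (fun p hp => absurd hp.1 hψ) (measure_empty (μ := volume))
  filter_upwards [compl_mem_ae_iff.mpr this] with y hy h1 h2 using hy ⟨h1, h2⟩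

theorem ae_fst_ne {f : ℝ → ℝ → ℝ} (hf : Measurable fun y : ℝ × ℝ × ℝ => f y.1 y.2.2) :
    ∀ᵐ y : ℝ × ℝ × ℝ, y.2.1 ≠ f y.1 y.2.2 := by
  have : volume {y : ℝ × ℝ × ℝ | y.2.1 = f y.1 y.2.2} = 0 := by
    refine volume_eq_zero_of_forall_line
      (measurableSet_eq_fun (measurable_fst.comp measurable_snd) hf) fun ψ q => ?_
    exact measure_mono_null (t := {f ψ q}) (fun p hp => hp) (measure_singleton _)
  exact compl_mem_ae_iff.mpr this

theorem ae_fiberSum_eq : ∀ᵐ y : ℝ × ℝ × ℝ, y.1 ∈ Set.Ioo 0 (Real.pi / 2) → y.2.2 < 0 →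
    fiberSum y = ENNReal.ofReal (2 * Real.cos y.1 * Real.sin y.1) *
      rootSum (Real.cos y.1 ^ 2) y.2.1 y.2.2 := by
  have hf : Measurable fun y : ℝ × ℝ × ℝ =>
      (1 + y.2.2 / (2 * (1 - Real.cos y.1 ^ 2))) + Real.cos y.1 ^ 2 - 2 + y.2.2 / 2 := by
    fun_prop
  filter_upwards [ae_resR_ne_zero (u := 0) (by simp), ae_resR_ne_zero (u := 1) (by simp),
    ae_fst_ne (f := fun ψ q => (1 + q / (2 * (1 - Real.cos ψ ^ 2))) + Real.cos ψ ^ 2 - 2 + q / 2)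
      hf,
    compl_mem_ae_iff.mpr volume_image_angleCrit] with y h0 h1 hp hc hψ hq
  exact fiberSum_eq hψ hq (h0 hψ) (h1 hψ) hp hc

theorem fiberSum_eq_zero {ψ : ℝ} (hψ : ψ ∉ Set.Ioo 0 (Real.pi / 2)) (w : ℝ × ℝ) :
    fiberSum (ψ, w) = 0 := by
  refine ENNReal.tsum_eq_zero.mpr ?_
  rintro ⟨x, hx, h⟩
  exact absurd (congrArg Prod.fst h ▸ hx.1.1 : (ψ, w).1 ∈ _) hψ

/-! ### The density and the formula for `q < 0`. -/

/-- The density of `(P, Q)` as an integral of sums over fibers. -/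
noncomputable def fiberDensity (w : ℝ × ℝ) : ℝ≥0∞ :=
  ENNReal.ofReal (2 / Real.pi ^ 2) * ∫⁻ ψ : ℝ, fiberSum (ψ, w)

theorem measurable_fiberDensity : Measurable fiberDensity :=
  (measurable_fiberSum.lintegral_prod_left' (μ := volume)).const_mul _

theorem lintegral_PQ_eq_lintegral_fiberDensity {f : ℝ × ℝ → ℝ≥0∞} (hf : Measurable f) :
    ∫⁻ g, f (PQ g) ∂haarSO3 = ∫⁻ w, f w * fiberDensity w := by
  have hf2 : Measurable fun x : ℝ × ℝ × ℝ => f (angleMap x).2 :=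
    hf.comp (measurable_snd.comp contDiff_angleMap.continuous.measurable)
  have hV : ∫⁻ x in angleDomain, f (angleMap x).2 =
      ∫⁻ ψ in Set.Ioo 0 (Real.pi / 2), ∫⁻ φ in Set.Ioo 0 (Real.pi / 2),
        ∫⁻ c in Set.Ioo (-1 : ℝ) 1, f (pq φ ψ c) := by
    rw [angleDomain, Measure.volume_eq_prod, setLIntegral_prod _ hf2.aemeasurable]
    refine lintegral_congr fun ψ => ?_
    rw [Measure.volume_eq_prod, setLIntegral_prod
      (fun y : ℝ × ℝ => f (angleMap (ψ, y)).2) (hf2.comp measurable_prodMk_left).aemeasurable]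
    rfl
  rw [lintegral_PQ hf, ← hV, ← lintegral_mul_fiberSum (h := fun y => f y.2)
    (hf.comp measurable_snd), Measure.volume_eq_prod, lintegral_prod_symm (fun y => f y.2 * fiberSum y)
    ((hf.comp measurable_snd).mul measurable_fiberSum).aemeasurable,
    ← lintegral_const_mul' _ _ ENNReal.ofReal_ne_top]
  refine lintegral_congr fun w => ?_
  rw [fiberDensity, mul_left_comm]
  congr 1
  exact lintegral_const_mul (f w) (f := fun ψ => fiberSum (ψ, w))
    (measurable_fiberSum.comp measurable_prodMk_right)

theorem map_PQ_eq_withDensity : Measure.map PQ haarSO3 = volume.withDensity fiberDensity := by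
  ext s hs
  rw [← lintegral_indicator_one hs, lintegral_map (measurable_one.indicator hs)
    continuous_PQ.measurable,
    lintegral_PQ_eq_lintegral_fiberDensity (measurable_one.indicator hs), withDensity_apply _ hs,
    ← lintegral_indicator hs]
  refine lintegral_congr fun w => ?_
  by_cases hw : w ∈ s <;> simp [hw]

instance hasPDF_PQ : HasPDF PQ haarSO3 volume :=
  hasPDF_of_map_eq_withDensity continuous_PQ.measurable.aemeasurable fiberDensity
    measurable_fiberDensity.aemeasurable map_PQ_eq_withDensity

theorem rho_ae_eq_fiberDensity : rho =ᵐ[volume] fiberDensity := by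
  rw [rho, pdf_def, map_PQ_eq_withDensity]
  exact Measure.rnDeriv_withDensity volume measurable_fiberDensity

/-- The substitution `z = cos² ψ` holds for arbitrary `f`, so `rootSum` need not be shown measurable
in `z`. -/
theorem setLIntegral_cos_sq (f : ℝ → ℝ≥0∞) :
    ∫⁻ ψ in Set.Ioo 0 (Real.pi / 2), ENNReal.ofReal (2 * Real.cos ψ * Real.sin ψ) *
      f (Real.cos ψ ^ 2) = ∫⁻ z in Set.Icc (0 : ℝ) 1, f z := by
  have hpi := Real.pi_pos
  have hd (ψ : ℝ) : HasDerivAt (fun ψ => Real.cos ψ ^ 2) (-(2 * Real.cos ψ * Real.sin ψ)) ψ := by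
    refine ((Real.hasDerivAt_cos ψ).pow 2).congr_deriv ?_
    simp
  have hinj : Set.InjOn (fun ψ => Real.cos ψ ^ 2) (Set.Ioo 0 (Real.pi / 2)) := by
    intro a ha b hb h
    exact Real.injOn_cos ⟨ha.1.le, by linarith [ha.2]⟩ ⟨hb.1.le, by linarith [hb.2]⟩
      ((sq_eq_sq₀ (cos_pos_of_mem_Ioo ha).le (cos_pos_of_mem_Ioo hb).le).mp h)
  have himg : (fun ψ => Real.cos ψ ^ 2) '' Set.Ioo 0 (Real.pi / 2) = Set.Ioo 0 1 := by
    ext z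
    constructor
    · rintro ⟨ψ, hψ, rfl⟩
      exact ⟨pow_pos (cos_pos_of_mem_Ioo hψ) 2, cos_sq_lt_one hψ⟩
    · rintro ⟨h0, h1⟩
      have hs0 := Real.sqrt_pos.mpr h0
      have hs1 : Real.sqrt z < 1 := by
        rw [Real.sqrt_lt' one_pos]
        simpa using h1
      refine ⟨Real.arccos (Real.sqrt z), ⟨Real.arccos_pos.mpr hs1,
        Real.arccos_lt_pi_div_two.mpr hs0⟩, ?_⟩
      simp only
      rw [Real.cos_arccos (by linarith) hs1.le, Real.sq_sqrt h0.le]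
  rw [setLIntegral_congr Ioo_ae_eq_Icc.symm, ← himg,
    lintegral_image_eq_lintegral_abs_deriv_mul measurableSet_Ioo
      (fun ψ _ => (hd ψ).hasDerivWithinAt) hinj]
  refine setLIntegral_congr_fun measurableSet_Ioo fun ψ hψ => ?_
  have := cos_pos_of_mem_Ioo hψ
  have := sin_pos_of_mem_Ioo hψ
  rw [abs_neg, abs_of_pos (by positivity)]

theorem ae_snd_ne_zero : ∀ᵐ w : ℝ × ℝ, w.2 ≠ 0 := by
  have h : ∀ᵐ q : ℝ, q ≠ 0 := Measure.ae_ne volume 0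
  exact Measure.quasiMeasurePreserving_snd.ae h

theorem ae_fiberDensity_eq : ∀ᵐ w : ℝ × ℝ, w.2 < 0 → fiberDensity w = rhoFormula w.1 w.2 := by
  have h1 : ∀ᵐ x : (ℝ × ℝ) × ℝ, x.2 ∈ Set.Ioo 0 (Real.pi / 2) → x.1.2 < 0 →
      fiberSum (x.2, x.1) = ENNReal.ofReal (2 * Real.cos x.2 * Real.sin x.2) *
        rootSum (Real.cos x.2 ^ 2) x.1.1 x.1.2 :=
    (Measure.measurePreserving_swap (μ := (volume : Measure (ℝ × ℝ)))
      (ν := (volume : Measure ℝ))).quasiMeasurePreserving.ae ae_fiberSum_eq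
  filter_upwards [Measure.ae_ae_of_ae_prod h1] with w hw hq
  rw [fiberDensity, rhoFormula, ← setLIntegral_cos_sq (fun z => rootSum z w.1 w.2),
    ← setLIntegral_eq_of_support_subset (s := Set.Ioo 0 (Real.pi / 2)) fun ψ hψ => by
      by_contra h
      exact hψ (fiberSum_eq_zero h w)]
  congr 1
  refine setLIntegral_congr_fun_ae measurableSet_Ioo ?_
  filter_upwards [hw] with ψ h hψ using h hψ hq

theorem ae_rho_eq : ∀ᵐ w : ℝ × ℝ, -2 ≤ w.2 → w.2 ≤ 0 → rho w = rhoFormula w.1 w.2 := by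
  filter_upwards [rho_ae_eq_fiberDensity, ae_fiberDensity_eq, ae_snd_ne_zero] with w h1 h2 h3 _ h4
  rw [h1, h2 (lt_of_le_of_ne h4 h3)]

/-! ### The symmetry `q ↦ -q` and the support of the density. -/

/-- The rotation exchanging the `x` and `z` axes and reversing the `y` axis. -/
def axisSwap : SO3 := mkSO3 !![0, 0, 1; 0, -1, 0; 1, 0, 0]
  (by ext i j; fin_cases i <;> fin_cases j <;> simp [Matrix.mul_apply, Fin.sum_univ_three])
  (by simp [Matrix.det_fin_three])

/-- With `S` the symmetric involution `axisSwap`, `S J_z S = -J_z`, so conjugating `g` turns `C`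
into `-S C S` and negates the eigenvalues. -/
theorem PQ_axisSwap_conj (g : SO3) :
    PQ (axisSwap * g * axisSwap) = ((PQ g).1, -(PQ g).2) := by
  simp only [PQ_eq]
  simp [entry, axisSwap, mkSO3, Matrix.mul_apply, Matrix.vecMul, dotProduct,
    Fin.sum_univ_three]
  constructor <;> ring

/-- The reflection `(p, q) ↦ (p, -q)`. -/
def reflectQ (w : ℝ × ℝ) : ℝ × ℝ := (w.1, -w.2)

theorem measurePreserving_reflectQ : MeasurePreserving reflectQ volume volume :=
  (MeasurePreserving.id volume).prod (Measure.measurePreserving_neg (volume : Measure ℝ))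

theorem measurePreserving_reflectQ_law :
    MeasurePreserving reflectQ (Measure.map PQ haarSO3) (Measure.map PQ haarSO3) := by
  refine ⟨measurePreserving_reflectQ.measurable, ?_⟩
  ext s hs
  have hT := measurePreserving_reflectQ.measurable hs
  have h1 : PQ ⁻¹' (reflectQ ⁻¹' s) =
      (fun g => axisSwap * g) ⁻¹' ((fun g => g * axisSwap) ⁻¹' (PQ ⁻¹' s)) := by
    ext g
    simp only [Set.mem_preimage, PQ_axisSwap_conj, reflectQ]
  rw [Measure.map_apply measurePreserving_reflectQ.measurable hs,
    Measure.map_apply continuous_PQ.measurable hT, Measure.map_apply continuous_PQ.measurable hs,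
    h1, measure_preimage_mul, measure_preimage_mul_right]

theorem measurable_rho : Measurable rho := measurable_pdf PQ haarSO3 volume

theorem withDensity_rho : volume.withDensity rho = Measure.map PQ haarSO3 :=
  (map_eq_withDensity_pdf PQ haarSO3 volume).symm

theorem ae_rho_reflect : ∀ᵐ w : ℝ × ℝ, rho (w.1, -w.2) = rho w := by
  have hT := measurePreserving_reflectQ
  -- Finite total mass lets equality of the two measures be read off as almost everywhere equality
  -- of their densities.
  have hfin : ∫⁻ w, rho (reflectQ w) ≠ ∞ := by
    rw [hT.lintegral_comp measurable_rho, ← setLIntegral_univ, ← withDensity_apply _ .univ,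
      withDensity_rho]
    exact measure_ne_top _ _
  refine (withDensity_eq_iff (measurable_rho.comp hT.measurable).aemeasurable
    measurable_rho.aemeasurable hfin).mp ?_
  ext s hs
  have hs' := hT.measurable hs
  have hpre : reflectQ ⁻¹' (reflectQ ⁻¹' s) = s := by
    ext w
    simp [reflectQ]
  rw [withDensity_apply _ hs, withDensity_rho,
    ← measurePreserving_reflectQ_law.measure_preimage hs.nullMeasurableSet, ← withDensity_rho,
    withDensity_apply _ hs', ← hT.setLIntegral_comp_preimage hs' measurable_rho, hpre]
  rfl

theorem abs_PQ_snd_le (g : SO3) : |(PQ g).2| ≤ 2 := by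
  have r (i : Fin 3) : entry i 0 g ^ 2 + entry i 1 g ^ 2 + entry i 2 g ^ 2 = 1 := by
    have := congrFun (congrFun (mul_transpose_SO3 g) i) i
    simp [Matrix.mul_apply, Fin.sum_univ_three] at this
    simp only [entry]
    linarith
  have r0 := r 0
  have r1 := r 1
  have r2 := r 2
  rw [PQ_eq, abs_le]
  have h (i j : Fin 3) := sq_nonneg (entry i j g)
  constructor <;> simp only <;>
    linarith [h 0 0, h 0 1, h 0 2, h 1 0, h 1 1, h 1 2, h 2 0, h 2 1, h 2 2]

theorem ae_rho_eq_zero : ∀ᵐ w : ℝ × ℝ, 2 < |w.2| → rho w = 0 := by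
  have hs : MeasurableSet {w : ℝ × ℝ | 2 < |w.2|} :=
    measurableSet_lt measurable_const measurable_snd.abs
  have h0 : ∫⁻ w in {w : ℝ × ℝ | 2 < |w.2|}, rho w = 0 := by
    rw [← withDensity_apply _ hs, withDensity_rho, Measure.map_apply continuous_PQ.measurable hs]
    convert measure_empty (μ := haarSO3)
    ext g
    simpa using abs_PQ_snd_le g
  exact (ae_restrict_iff' hs).mp ((lintegral_eq_zero_iff measurable_rho).mp h0)

theorem ae_rho_eq_of_pos :
    ∀ᵐ w : ℝ × ℝ, 0 < w.2 → w.2 ≤ 2 → rho w = rhoFormula w.1 (-w.2) := by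
  filter_upwards [ae_rho_reflect, measurePreserving_reflectQ.quasiMeasurePreserving.ae ae_rho_eq]
    with w h1 h2 h3 h4
  rw [← h1]
  exact h2 (neg_le_neg h4) (neg_nonpos.mpr h3.le)

end HornSymm

theorem mainTheorem2 :
    -- the characteristic polynomial of the sum in Euler angles
    (∀ φ θ ψ : ℝ,
      (HornSymm.sumC (HornSymm.rotZ φ * HornSymm.rotY θ * HornSymm.rotZ ψ)).charpoly =
        X ^ 3 + C ((HornSymm.polyP 0 φ ψ).eval (Real.cos θ)) * X
          + C ((HornSymm.polyQ 0 φ ψ).eval (Real.cos θ))) ∧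
    -- for `-2 ≤ q ≤ 0` the real roots of `Q_q` lie in `[-1, 1]`
    (∀ q φ ψ : ℝ, -2 ≤ q → q ≤ 0 → HornSymm.polyQ q φ ψ ≠ 0 →
      ∀ c : ℝ, (HornSymm.polyQ q φ ψ).IsRoot c → c ∈ Set.Icc (-1 : ℝ) 1) ∧
    -- `R` is the resultant of `P_p` and `Q_q`, of degree 4 in `u`, and symmetric
    (∀ p q φ ψ : ℝ,
      resultant (HornSymm.polyP p φ ψ) (HornSymm.polyQ q φ ψ) 2 2 =
        HornSymm.resR (Real.cos φ ^ 2) (Real.cos ψ ^ 2) p q) ∧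
    (∀ z p q : ℝ, (HornSymm.polyR z p q).natDegree = 4) ∧
    (∀ u z p q : ℝ, HornSymm.resR u z p q = HornSymm.resR z u p q) ∧
    -- the law of `(P, Q)` has a density
    HasPDF HornSymm.PQ HornSymm.haarSO3 volume ∧
    -- the density for `-2 ≤ q ≤ 0`
    (∀ᵐ w : ℝ × ℝ, -2 ≤ w.2 → w.2 ≤ 0 →
      HornSymm.rho w = HornSymm.rhoFormula w.1 w.2) ∧
    -- the symmetry `q → -q`, and the resulting density for all other `q`
    (∀ᵐ w : ℝ × ℝ, HornSymm.rho (w.1, -w.2) = HornSymm.rho w) ∧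
    (∀ᵐ w : ℝ × ℝ, 0 < w.2 → w.2 ≤ 2 →
      HornSymm.rho w = HornSymm.rhoFormula w.1 (-w.2)) ∧
    (∀ᵐ w : ℝ × ℝ, 2 < |w.2| → HornSymm.rho w = 0) := by
  open HornSymm in
  exact ⟨charpoly_sumC_euler, fun q φ ψ _ hq h0 c hc => isRoot_polyQ_mem_Icc hq h0 hc,
    resultant_polyP_polyQ, natDegree_polyR, resR_symm, hasPDF_PQ, ae_rho_eq, ae_rho_reflect,
    ae_rho_eq_of_pos, ae_rho_eq_zero⟩
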